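/- Conventions. All algebras are associative and real; neither algebras nor homomorphisms are assumed to be unital. For a real Banach algebra $B$ let $B_+$ be the Banach algebra obtained by adjoining an identity to $B$. An element $b\in B$ is *of polynomial growth* if there are $K>0$ and $\alpha\ge 0$ such that $\|e^{isb}\|\le K(1+|s|)^{\alpha}$ for all $s\in\mathbb{R}$, where the exponential and the norm are taken in the complexification of $B_+$. Let $\mathsf{PG}$ be the class of real Banach algebras all of whose elements are of polynomial growth, and $\mathsf{PGL}$ the class of real topological algebras that are isomorphic, as topological algebras, to a projective limit of a directed system of algebras in $\mathsf{PG}$ with continuous linking homomorphisms. An *envelope with respect to $\mathsf{PG}$* of a real topological algebra $A$ is an algebra $E$ in $\mathsf{PGL}$ with a continuous homomorphism $\iota\colon A\to E$ such that for every algebra $B$ in $\mathsf{PGL}$ (in particular, for every $B$ in $\mathsf{PG}$) and every continuous homomorphism $\varphi\colon A\to B$ there is a unique continuous homomorphism $\widehat\varphi\colon E\to B$ with $\widehat\varphi\circ\iota=\varphi$. Proposition. Let $n\in\mathbb{N}$. Endow $\mathbb{R}[x_1,\dots,x_n]$ with the strongest locally convex topology, and the algebra $C^\infty(\mathbb{R}^n)$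 of real-valued smooth functions with the topology of uniform convergence on compact sets of functions and all their derivatives. Then the natural embedding $\mathbb{R}[x_1,\dots,x_n]\to C^\infty(\mathbb{R}^n)$, which sends each $x_i$ to the $i$-th coordinate function, is an envelope with respect to $\mathsf{PG}$. -/

import Mathlib

open scoped ContDiff Manifold Topology

universe u v w

noncomputable section

/-! ### Complexification of a real normed algebra -/

/-- The complexification `A + iA` of a real algebra `A`, as the space of pairs `(a, b) = a + ib`
with the norm `‖a + ib‖ = ‖a‖ + ‖b‖`. This norm extends the norm of `A`, is submultiplicative, and
is equivalent to every norm extending that of `A` and making `A + iA` a complex Banach algebra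
(when `A` is complete), so that polynomial growth does not depend on the choice. -/
def Complexification (A : Type u) : Type u := WithLp 1 (A × A)

namespace Complexification

/-- The element `a + ib`. -/
def mk {A : Type u} (a b : A) : Complexification A := WithLp.toLp 1 (a, b)

/-- The real part of `a + ib` is `a`. -/
def re {A : Type u} (z : Complexification A) : A := WithLp.fst z

/-- The imaginary part of `a + ib` is `b`. -/
def im {A : Type u} (z : Complexification A) : A := WithLp.snd z

@[simp] theorem re_mk {A : Type u} (a b : A) : (mk a b).re = a := rfl

@[simp] theorem im_mk {A : Type u} (a b : A) : (mk a b).im = b := rfl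

@[ext] theorem ext {A : Type u} {z w : Complexification A} (h₁ : z.re = w.re)
    (h₂ : z.im = w.im) : z = w := by
  show mk z.re z.im = mk w.re w.im
  rw [h₁, h₂]

section Normed

variable {A : Type u} [NormedRing A]

instance : NormedAddCommGroup (Complexification A) :=
  inferInstanceAs (NormedAddCommGroup (WithLp 1 (A × A)))

instance [CompleteSpace A] : CompleteSpace (Complexification A) :=
  inferInstanceAs (CompleteSpace (WithLp 1 (A × A)))

theorem norm_def (z : Complexification A) : ‖z‖ = ‖z.re‖ + ‖z.im‖ :=
  WithLp.prod_norm_eq_of_L1 z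

@[simp] theorem re_zero : (0 : Complexification A).re = 0 := rfl

@[simp] theorem im_zero : (0 : Complexification A).im = 0 := rfl

@[simp] theorem re_add (z w : Complexification A) : (z + w).re = z.re + w.re := rfl

@[simp] theorem im_add (z w : Complexification A) : (z + w).im = z.im + w.im := rfl

instance : One (Complexification A) := ⟨mk 1 0⟩

/-- `(a + ib)(c + id) = (ac - bd) + i(ad + bc)`. -/
instance : Mul (Complexification A) :=
  ⟨fun z w => mk (z.re * w.re - z.im * w.im) (z.re * w.im + z.im * w.re)⟩

@[simp] theorem re_one : (1 : Complexification A).re = 1 := rfl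

@[simp] theorem im_one : (1 : Complexification A).im = 0 := rfl

@[simp] theorem re_mul (z w : Complexification A) :
    (z * w).re = z.re * w.re - z.im * w.im := rfl

@[simp] theorem im_mul (z w : Complexification A) :
    (z * w).im = z.re * w.im + z.im * w.re := rfl

instance : NormedRing (Complexification A) where
  left_distrib x y z := by ext <;> simp <;> noncomm_ring
  right_distrib x y z := by ext <;> simp <;> noncomm_ring
  zero_mul x := by ext <;> simp
  mul_zero x := by ext <;> simp
  mul_assoc x y z := by ext <;> simp <;> noncomm_ring
  one_mul x := by ext <;> simp
  mul_one x := by ext <;> simp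
  neg_add_cancel x := neg_add_cancel x
  zsmul := fun n x => n • x
  zsmul_zero' x := zero_zsmul x
  zsmul_succ' n x := SubNegMonoid.zsmul_succ' n x
  zsmul_neg' n x := SubNegMonoid.zsmul_neg' n x
  sub_eq_add_neg x y := sub_eq_add_neg x y
  dist_eq := NormedAddCommGroup.dist_eq
  norm_mul_le z w := by
    simp only [norm_def, re_mul, im_mul]
    calc ‖z.re * w.re - z.im * w.im‖ + ‖z.re * w.im + z.im * w.re‖
        ≤ (‖z.re * w.re‖ + ‖z.im * w.im‖) + (‖z.re * w.im‖ + ‖z.im * w.re‖) :=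
          add_le_add (norm_sub_le _ _) (norm_add_le _ _)
      _ ≤ (‖z.re‖ * ‖w.re‖ + ‖z.im‖ * ‖w.im‖) + (‖z.re‖ * ‖w.im‖ + ‖z.im‖ * ‖w.re‖) := by
          gcongr <;> exact norm_mul_le _ _
      _ = (‖z.re‖ + ‖z.im‖) * (‖w.re‖ + ‖w.im‖) := by ring

variable [NormedAlgebra ℝ A]

/-- `(x + iy)(a + ib) = (xa - yb) + i(xb + ya)`. -/
instance : SMul ℂ (Complexification A) :=
  ⟨fun c z => mk (c.re • z.re - c.im • z.im) (c.re • z.im + c.im • z.re)⟩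

@[simp] theorem re_smul (c : ℂ) (z : Complexification A) :
    (c • z).re = c.re • z.re - c.im • z.im := rfl

@[simp] theorem im_smul (c : ℂ) (z : Complexification A) :
    (c • z).im = c.re • z.im + c.im • z.re := rfl

instance : Module ℂ (Complexification A) where
  one_smul z := by ext <;> simp
  mul_smul c d z := by ext <;> simp <;> module
  smul_zero c := by ext <;> simp
  smul_add c z w := by ext <;> simp <;> module
  add_smul c d z := by ext <;> simp <;> module
  zero_smul z := by ext <;> simp

instance : Algebra ℂ (Complexification A) :=
  Algebra.ofModule
    (fun c z w => by ext <;> simp [sub_mul, add_mul, smul_sub, smul_add] <;> abel)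
    (fun c z w => by ext <;> simp [mul_sub, mul_add, smul_sub, smul_add] <;> abel)

end Normed

end Complexification

/-! ### Real Banach algebras of polynomial growth -/

section PolynomialGrowth

variable (B : Type u) [NonUnitalNormedRing B] [NormedSpace ℝ B] [IsScalarTower ℝ B B]
  [SMulCommClass ℝ B B]

/-- The algebra `B₊` obtained from a real normed algebra `B` (unital or not) by adjoining an
identity, with the norm `‖λ1 + b‖₊ = |λ| + ‖b‖`. -/
abbrev AdjoinOne : Type u := WithLp 1 (Unitization ℝ B)

variable {B}

/-- An element `b` of a real Banach algebra `B` viewed in the complexification of `B₊`. -/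
def toComplexification (b : B) : Complexification (AdjoinOne B) :=
  Complexification.mk (WithLp.toLp 1 (b : Unitization ℝ B)) 0

/-- An element `b` of a real Banach algebra is of polynomial growth if there are `K > 0` and
`α ≥ 0` with `‖exp (isb)‖₊ ≤ K (1 + |s|) ^ α` for all real `s`, the exponential being taken in the
complexification of `B₊`. -/
def IsOfPolynomialGrowth (b : B) : Prop :=
  ∃ K : ℝ, 0 < K ∧ ∃ α : ℝ, 0 ≤ α ∧ ∀ s : ℝ,
    ‖NormedSpace.exp ((Complex.I * (s : ℂ)) • toComplexification b)‖ ≤ K * (1 + |s|) ^ α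

variable (B)

/-- The class `PG`: a real Banach algebra is of polynomial growth if all its elements are. -/
def IsPG : Prop := CompleteSpace B ∧ ∀ b : B, IsOfPolynomialGrowth b

end PolynomialGrowth

/-! ### Projective limits of algebras in `PG` -/

/-- A projective (inverse) system, over a nonempty directed preordered set `I`, of real Banach
algebras of polynomial growth with continuous homomorphisms as linking maps. -/
structure PGSystem (I : Type v) [Preorder I] where
  obj : I → Type v
  [ring : ∀ i, NonUnitalNormedRing (obj i)]
  [space : ∀ i, NormedSpace ℝ (obj i)]
  [tower : ∀ i, IsScalarTower ℝ (obj i) (obj i)]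
  [comm : ∀ i, SMulCommClass ℝ (obj i) (obj i)]
  isPG : ∀ i, IsPG (obj i)
  map : ∀ {i j : I}, i ≤ j → (obj j →ₙₐ[ℝ] obj i)
  continuous_map : ∀ {i j : I} (h : i ≤ j), Continuous (map h)
  map_self : ∀ (i : I) (x : obj i), map (le_refl i) x = x
  map_map : ∀ {i j k : I} (hij : i ≤ j) (hjk : j ≤ k) (x : obj k),
    map hij (map hjk x) = map (hij.trans hjk) x

attribute [instance] PGSystem.ring PGSystem.space PGSystem.tower PGSystem.comm

/-- The projective limit of a system: the algebra of compatible families, a subalgebra of the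
product, with the topology induced by the product topology. -/
def PGSystem.limit {I : Type v} [Preorder I] (S : PGSystem I) :
    NonUnitalSubalgebra ℝ (∀ i, S.obj i) where
  carrier := {x | ∀ (i j : I) (h : i ≤ j), S.map h (x j) = x i}
  add_mem' hx hy i j h := by simp [hx i j h, hy i j h]
  zero_mem' i j h := by simp
  mul_mem' hx hy i j h := by simp [hx i j h, hy i j h]
  smul_mem' c x hx i j h := by simp [hx i j h]

/-- The class `PGL`: `A` is locally in `PG` if it is isomorphic, as a topological algebra, to a
projective limit of real Banach algebras of polynomial growth. -/
def IsPGL (A : Type v) [NonUnitalRing A] [Module ℝ A] [TopologicalSpace A] : Prop :=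
  ∃ (I : Type v) (_ : Preorder I) (_ : IsDirectedOrder I) (_ : Nonempty I) (S : PGSystem I)
    (e : A →ₙₐ[ℝ] S.limit), IsHomeomorph e

/-- Every Banach algebra of polynomial growth is in `PGL`. -/
theorem IsPG.isPGL {B : Type v} [NonUnitalNormedRing B] [NormedSpace ℝ B] [IsScalarTower ℝ B B]
    [SMulCommClass ℝ B B] (hB : IsPG B) : IsPGL B := by
  let S : PGSystem PUnit.{v + 1} :=
    { obj := fun _ => B
      isPG := fun _ => hB
      map := fun _ => NonUnitalAlgHom.id ℝ B
      continuous_map := fun _ => continuous_id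
      map_self := fun _ _ => rfl
      map_map := fun _ _ _ => rfl }
  let e : B →ₙₐ[ℝ] S.limit :=
    { toFun := fun b => ⟨fun _ => b, fun _ _ _ => rfl⟩
      map_smul' := fun _ _ => rfl
      map_zero' := rfl
      map_add' := fun _ _ => rfl
      map_mul' := fun _ _ => rfl }
  let f : B ≃ₜ S.limit :=
    { toFun := e
      invFun := fun x => x.1 PUnit.unit
      left_inv := fun _ => rfl
      right_inv := fun _ => rfl
      continuous_toFun := Continuous.subtype_mk (continuous_pi fun _ => continuous_id) _
      continuous_invFun := (continuous_apply PUnit.unit).comp continuous_subtype_val }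
  exact ⟨PUnit.{v + 1}, inferInstance, inferInstance, inferInstance, S, e, f.isHomeomorph⟩

/-! ### Envelopes with respect to `PG` -/

/-- `ι : A → E` is an envelope of the real topological algebra `A` with respect to `PG`: the
algebra `E` is in `PGL`, `ι` is a continuous homomorphism, and every continuous homomorphism `φ`
from `A` to a `PGL` algebra `B` (in particular, to a Banach algebra `B` of polynomial growth, see
`IsPG.isPGL`) factors through `ι` by a unique continuous homomorphism `ψ : E → B`. Neither algebras
nor homomorphisms are required to be unital. -/
structure IsPGEnvelope {A : Type w} {E : Type v} [NonUnitalRing A] [Module ℝ A]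
    [TopologicalSpace A] [NonUnitalRing E] [Module ℝ E] [TopologicalSpace E]
    (ι : A →ₙₐ[ℝ] E) : Prop where
  isPGL : IsPGL E
  continuous : Continuous ι
  existsUnique_lift : ∀ (B : Type u) [NonUnitalRing B] [Module ℝ B] [TopologicalSpace B],
    IsPGL B → ∀ φ : A →ₙₐ[ℝ] B, Continuous φ →
      ∃! ψ : E →ₙₐ[ℝ] B, Continuous ψ ∧ ∀ a : A, ψ (ι a) = φ a

/-! ### Polynomials and smooth functions -/

/-- The strongest (finest) locally convex topology on a real vector space. -/
@[reducible] def strongestLocallyConvexTopology (V : Type u) [AddCommGroup V] [Module ℝ V] :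
    TopologicalSpace V :=
  sInf {t | @IsTopologicalAddGroup V t _ ∧ @ContinuousSMul ℝ V _ _ t ∧
    @LocallyConvexSpace ℝ V _ _ _ _ t}

/-- The algebra `C^∞(ℝⁿ)` of real-valued smooth functions on `ℝⁿ`. -/
abbrev SmoothFunctions (n : ℕ) : Type :=
  C^∞⟮𝓘(ℝ, EuclideanSpace ℝ (Fin n)), EuclideanSpace ℝ (Fin n); 𝓘(ℝ, ℝ), ℝ⟯

/-- The standard topology of `C^∞(ℝⁿ)`: uniform convergence on compact sets of the functions and
of all their derivatives. -/
instance SmoothFunctions.instTopologicalSpace (n : ℕ) : TopologicalSpace (SmoothFunctions n) :=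
  ⨅ k : ℕ, TopologicalSpace.induced
    (fun f : SmoothFunctions n =>
      UniformOnFun.ofFun {K : Set (EuclideanSpace ℝ (Fin n)) | IsCompact K}
        (iteratedFDeriv ℝ k (f : EuclideanSpace ℝ (Fin n) → ℝ)))
    inferInstance

/-- The `i`-th coordinate function on `ℝⁿ`. -/
def coordinateFunction (n : ℕ) (i : Fin n) : SmoothFunctions n :=
  ⟨fun x => x i, by
    rw [contMDiff_iff_contDiff]
    exact (EuclideanSpace.proj (𝕜 := ℝ) i).contDiff⟩

/-- The natural embedding `ℝ[x₁, …, xₙ] → C^∞(ℝⁿ)`: the homomorphism of unital algebras sending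
each variable to the corresponding coordinate function. -/
def polynomialEmbedding (n : ℕ) : MvPolynomial (Fin n) ℝ →ₐ[ℝ] SmoothFunctions n :=
  MvPolynomial.aeval (coordinateFunction n)

end

/-! Two facts are needed: `SmoothFunctions n` lies in PGL, and every homomorphism from the
polynomials to a PG algebra is bounded by one of its seminorms.

Membership. The topology is given by submultiplicative seminorms measuring derivatives of order at
most `N` on the ball of radius `N` (`topology_eq_iInf`), and the space is the projective limit of
the corresponding completions. For real `f`, Euler's formula reduces `e^{isf}` to `cos (sf)` and
`sin (sf)`. By the Faà di Bruno estimate their `N`-th seminorms grow at most like `(1 + |s|) ^ N`,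
with a constant depending only on the norm of `f`. The bound therefore passes from smooth functions
to the completion (`isPG_completion`).

Boundedness (`IsPG.exists_norm_map_le`). The closure of the range of `φ` is commutative and again in
PG. The sine is locally onto near `0` in a real Banach algebra, so after scaling `φ (X j) = R sin
c_j` with `c_j` in the algebra. Then `φ p` is `φ 1` times the trigonometric polynomial `p (R sin θ₁,
…, R sin θₙ)` evaluated at the units `e^{ic_j}`. The powers of these units grow polynomially, while
the Fourier coefficients decay at any prescribed polynomial rate with constants controlled by
finitely many derivatives of `p`; hence the sum is bounded by a seminorm of `p`.

Polynomials are dense in the smooth functions, by convolution with polynomial approximations of a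
mollifier. The bound thus gives a continuous extension to any Banach algebra in PG, and
coordinatewise to a projective limit; density also gives uniqueness. -/

noncomputable section

/-! ### Conjugation, functoriality and characters of the complexification -/

namespace Complexification

variable {A : Type u} [NormedRing A]

@[simp] theorem re_neg (z : Complexification A) : (-z).re = -z.re := rfl

@[simp] theorem im_neg (z : Complexification A) : (-z).im = -z.im := rfl

@[simp] theorem re_sub (z w : Complexification A) : (z - w).re = z.re - w.re := by
  simp [sub_eq_add_neg]

@[simp] theorem im_sub (z w : Complexification A) : (z - w).im = z.im - w.im := by
  simp [sub_eq_add_neg]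

/-- The conjugation `a + ib ↦ a - ib`. -/
def conj : Complexification A →+* Complexification A where
  toFun z := mk z.re (-z.im)
  map_one' := by ext <;> simp
  map_mul' z w := by
    ext
    · simp
    · simp; abel
  map_zero' := by ext <;> simp
  map_add' z w := by
    ext
    · simp
    · simp; abel

@[simp] theorem re_conj (z : Complexification A) : (conj z).re = z.re := rfl

@[simp] theorem im_conj (z : Complexification A) : (conj z).im = -z.im := rfl

theorem norm_conj (z : Complexification A) : ‖conj z‖ = ‖z‖ := by simp [norm_def]

theorem continuous_conj : Continuous (conj : Complexification A → Complexification A) :=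
  AddMonoidHomClass.continuous_of_bound conj 1 fun z => by rw [norm_conj, one_mul]

variable [NormedAlgebra ℝ A]

theorem real_smul_eq (r : ℝ) (z : Complexification A) : r • z = mk (r • z.re) (r • z.im) := by
  change (r : ℂ) • z = _
  ext
  · rw [re_smul]; simp
  · rw [im_smul]; simp

@[simp] theorem re_real_smul (r : ℝ) (z : Complexification A) : (r • z).re = r • z.re := by
  rw [real_smul_eq, re_mk]

@[simp] theorem im_real_smul (r : ℝ) (z : Complexification A) : (r • z).im = r • z.im := by
  rw [real_smul_eq, im_mk]

instance normedAlgebraReal : NormedAlgebra ℝ (Complexification A) where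
  norm_smul_le r z := by
    rw [real_smul_eq, norm_def, norm_def]
    simp [norm_smul, mul_add]

instance isScalarTowerComplex :
    IsScalarTower ℂ (Complexification A) (Complexification A) :=
  ⟨fun c z w => Algebra.smul_mul_assoc c z w⟩

instance smulCommClassComplex :
    SMulCommClass ℂ (Complexification A) (Complexification A) :=
  ⟨fun c z w => (Algebra.mul_smul_comm c z w).symm⟩

theorem norm_complex_smul_le (c : ℂ) (z : Complexification A) : ‖c • z‖ ≤ 2 * (‖c‖ * ‖z‖) := by
  have h : c • z = c.re • z + c.im • (Complex.I • z) := by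
    ext <;> simp [sub_eq_add_neg]
  have hI : ‖Complex.I • z‖ = ‖z‖ := by
    simp [norm_def, add_comm]
  calc ‖c • z‖ ≤ ‖c.re • z‖ + ‖c.im • (Complex.I • z)‖ := by rw [h]; exact norm_add_le _ _
    _ ≤ ‖c‖ * ‖z‖ + ‖c‖ * ‖z‖ := by
        rw [norm_smul, norm_smul, hI]
        gcongr
        · exact Complex.abs_re_le_norm c
        · exact Complex.abs_im_le_norm c
    _ = _ := by ring

/-- Multiplication by a complex scalar, as a continuous real linear map. -/
def complexSMul (c : ℂ) : Complexification A →L[ℝ] Complexification A :=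
  LinearMap.mkContinuous
    { toFun := fun z => c • z
      map_add' := smul_add c
      map_smul' := fun r z => smul_comm c r z } (2 * ‖c‖)
    fun z => (norm_complex_smul_le c z).trans_eq (mul_assoc _ _ _).symm

@[simp] theorem complexSMul_apply (c : ℂ) (z : Complexification A) : complexSMul c z = c • z := rfl

/-- The imaginary part, as a continuous real linear map. -/
def imCLM : Complexification A →L[ℝ] A :=
  LinearMap.mkContinuous
    { toFun := im
      map_add' := im_add
      map_smul' := im_real_smul } 1
    fun z => by
      rw [one_mul, norm_def]
      exact le_add_of_nonneg_left (norm_nonneg _)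

@[simp] theorem imCLM_apply (z : Complexification A) : imCLM z = z.im := rfl

variable {A' : Type v} [NormedRing A'] [NormedAlgebra ℝ A']

/-- The homomorphism of complexifications induced by a homomorphism of real algebras. -/
def map (f : A →ₐ[ℝ] A') : Complexification A →ₐ[ℂ] Complexification A' :=
  AlgHom.ofLinearMap
    { toFun := fun z => mk (f z.re) (f z.im)
      map_add' := fun z w => by ext <;> simp
      map_smul' := fun c z => by ext <;> simp }
    (by ext <;> simp) fun z w => by ext <;> simp

@[simp] theorem re_map (f : A →ₐ[ℝ] A') (z : Complexification A) : (map f z).re = f z.re := rfl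

@[simp] theorem im_map (f : A →ₐ[ℝ] A') (z : Complexification A) : (map f z).im = f z.im := rfl

/-- The complex character extending a real character. -/
def character (f : A →ₐ[ℝ] ℝ) : Complexification A →+* ℂ where
  toFun z := ⟨f z.re, f z.im⟩
  map_one' := by apply Complex.ext <;> simp
  map_mul' z w := by apply Complex.ext <;> simp
  map_zero' := by apply Complex.ext <;> simp
  map_add' z w := by apply Complex.ext <;> simp

@[simp] theorem character_re (f : A →ₐ[ℝ] ℝ) (z : Complexification A) :
    (character f z).re = f z.re := rfl

@[simp] theorem character_im (f : A →ₐ[ℝ] ℝ) (z : Complexification A) :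
    (character f z).im = f z.im := rfl

theorem continuous_character (f : A →ₐ[ℝ] ℝ) (hf : ∀ a, ‖f a‖ ≤ ‖a‖) :
    Continuous (character f) :=
  AddMonoidHomClass.continuous_of_bound (character f) 1 fun z => by
    rw [one_mul, norm_def]
    exact (Complex.norm_le_abs_re_add_abs_im _).trans (add_le_add (hf _) (hf _))

end Complexification

/-! ### Adjoining an identity, and functoriality of polynomial growth -/

theorem AdjoinOne.eq_inr_of_fst_eq_zero {B : Type u} [Zero B] {a : AdjoinOne B}
    (h : (WithLp.ofLp a).fst = 0) :
    a = WithLp.toLp 1 (((WithLp.ofLp a).snd : B) : Unitization ℝ B) := by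
  have : WithLp.ofLp a = (((WithLp.ofLp a).snd : B) : Unitization ℝ B) := by
    ext <;> simp [h]
  rw [← this]

section PolynomialGrowth

variable {B : Type u} [NonUnitalNormedRing B] [NormedSpace ℝ B] [IsScalarTower ℝ B B]
  [SMulCommClass ℝ B B]

/-- The complexification of `B₊`. -/
abbrev ComplexUnitization (B : Type u) [NonUnitalNormedRing B] [NormedSpace ℝ B]
    [IsScalarTower ℝ B B] [SMulCommClass ℝ B B] : Type u := Complexification (AdjoinOne B)

instance ComplexUnitization.normedAlgebraRat : NormedAlgebra ℚ (ComplexUnitization B) :=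
  NormedAlgebra.restrictScalars ℚ ℝ _

namespace AdjoinOne

theorem norm_def (a : AdjoinOne B) :
    ‖a‖ = ‖(WithLp.ofLp a).fst‖ + ‖(WithLp.ofLp a).snd‖ :=
  WithLp.unitization_norm_def a

theorem norm_one : ‖(1 : AdjoinOne B)‖ = 1 := by
  rw [norm_def]
  change ‖(1 : ℝ)‖ + ‖(0 : B)‖ = 1
  simp

/-- The character of `B₊` with kernel `B`. -/
def fstHom : AdjoinOne B →ₐ[ℝ] ℝ :=
  (Unitization.fstHom ℝ B).comp (WithLp.unitizationAlgEquiv ℝ).toAlgHom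

@[simp] theorem fstHom_apply (a : AdjoinOne B) : fstHom a = (WithLp.ofLp a).fst := rfl

theorem norm_fstHom_le (a : AdjoinOne B) : ‖fstHom a‖ ≤ ‖a‖ := by
  rw [norm_def, fstHom_apply]
  exact le_add_of_nonneg_right (norm_nonneg _)

/-- The projection of `B₊` onto `B`. -/
def sndCLM : AdjoinOne B →L[ℝ] B :=
  LinearMap.mkContinuous
    { toFun := fun a => (WithLp.ofLp a).snd
      map_add' := fun _ _ => rfl
      map_smul' := fun _ _ => rfl } 1
    fun a => by
      rw [one_mul, norm_def]
      exact le_add_of_nonneg_left (norm_nonneg _)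

@[simp] theorem sndCLM_apply (a : AdjoinOne B) : sndCLM a = (WithLp.ofLp a).snd := rfl

variable {B' : Type v} [NonUnitalNormedRing B'] [NormedSpace ℝ B'] [IsScalarTower ℝ B' B']
  [SMulCommClass ℝ B' B']

/-- The unital homomorphism `B₊ → B'₊` induced by a homomorphism `B → B'`. -/
def map (f : B →ₙₐ[ℝ] B') : AdjoinOne B →ₐ[ℝ] AdjoinOne B' :=
  ((WithLp.unitizationAlgEquiv ℝ).symm.toAlgHom.comp
    (Unitization.lift ((Unitization.inrNonUnitalAlgHom ℝ B').comp f))).comp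
      (WithLp.unitizationAlgEquiv ℝ).toAlgHom

theorem map_apply (f : B →ₙₐ[ℝ] B') (a : AdjoinOne B) :
    WithLp.ofLp (map f a) = Unitization.inl (WithLp.ofLp a).fst +
      ((f (WithLp.ofLp a).snd : B') : Unitization ℝ B') := rfl

theorem norm_map (f : B →ₙₐ[ℝ] B') (hf : ∀ b, ‖f b‖ = ‖b‖) (a : AdjoinOne B) :
    ‖map f a‖ = ‖a‖ := by
  rw [norm_def, norm_def, map_apply]
  simp [hf]

end AdjoinOne

theorem ComplexUnitization.norm_one : ‖(1 : ComplexUnitization B)‖ = 1 := by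
  rw [Complexification.norm_def, Complexification.re_one, Complexification.im_one, norm_zero,
    add_zero, AdjoinOne.norm_one]

/-- The embedding of `B` into the complexification of `B₊` as a homomorphism of real algebras. -/
def toComplexificationHom : B →ₙₐ[ℝ] ComplexUnitization B where
  toFun := toComplexification
  map_smul' r b := by
    ext <;> simp [toComplexification]
  map_zero' := by
    ext <;> simp [toComplexification]
  map_add' a b := by
    ext <;> simp [toComplexification]
  map_mul' a b := by
    ext1
    · simp only [toComplexification, Complexification.re_mk, Complexification.re_mul,
        Unitization.inr_mul, Complexification.im_mk, mul_zero, sub_zero]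
      rfl
    · simp [toComplexification]

@[simp] theorem toComplexificationHom_apply (b : B) :
    toComplexificationHom b = toComplexification b := rfl

theorem norm_toComplexification (b : B) : ‖toComplexification b‖ = ‖b‖ := by
  simp [toComplexification, Complexification.norm_def, WithLp.unitization_norm_inr]

/-- The embedding of `B` into the complexification of `B₊` as a continuous real linear map. -/
def toComplexificationCLM : B →L[ℝ] ComplexUnitization B :=
  LinearMap.mkContinuous (toComplexificationHom : B →ₙₐ[ℝ] ComplexUnitization B) 1
    fun b => by
      rw [one_mul]
      exact (norm_toComplexification b).le

@[simp] theorem toComplexificationCLM_apply (b : B) :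
    toComplexificationCLM b = toComplexification b := rfl

section Functoriality

variable {B' : Type v} [NonUnitalNormedRing B'] [NormedSpace ℝ B'] [IsScalarTower ℝ B' B']
  [SMulCommClass ℝ B' B']

theorem map_toComplexification (f : B →ₙₐ[ℝ] B') (b : B) :
    Complexification.map (AdjoinOne.map f) (toComplexification b) = toComplexification (f b) := by
  have h : AdjoinOne.map f (WithLp.toLp 1 (b : Unitization ℝ B)) =
      WithLp.toLp 1 ((f b : B') : Unitization ℝ B') := by
    apply (WithLp.ofLp_injective 1)
    rw [AdjoinOne.map_apply]
    simp
  ext1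
  · exact h
  · exact map_zero (AdjoinOne.map f)

theorem norm_complexification_map (f : B →ₙₐ[ℝ] B') (hf : ∀ b, ‖f b‖ = ‖b‖)
    (z : ComplexUnitization B) : ‖Complexification.map (AdjoinOne.map f) z‖ = ‖z‖ := by
  simp [Complexification.norm_def, AdjoinOne.norm_map f hf]

/-- An isometric homomorphism stays isometric on the complexified unitizations and commutes with the
exponential. This is what lets polynomial growth be tested inside a subalgebra. -/
theorem isOfPolynomialGrowth_map_iff [CompleteSpace B] (f : B →ₙₐ[ℝ] B')
    (hf : ∀ b, ‖f b‖ = ‖b‖) (b : B) : IsOfPolynomialGrowth (f b) ↔ IsOfPolynomialGrowth b := by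
  have hcont : Continuous (Complexification.map (AdjoinOne.map f)) :=
    AddMonoidHomClass.continuous_of_bound _ 1 fun z => by
      rw [norm_complexification_map f hf, one_mul]
  have key (s : ℝ) : ‖NormedSpace.exp ((Complex.I * (s : ℂ)) • toComplexification (f b))‖ =
      ‖NormedSpace.exp ((Complex.I * (s : ℂ)) • toComplexification b)‖ := by
    rw [← norm_complexification_map f hf, NormedSpace.map_exp _ hcont, map_smul,
      map_toComplexification]
  simp only [IsOfPolynomialGrowth, key]

end Functoriality

/-! ### The sine in a real Banach algebra -/

section Sine

/-- The element `e^{ic}` of the complexification of `B₊`. -/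
def expI (c : B) : ComplexUnitization B := NormedSpace.exp (Complex.I • toComplexification c)

variable [CompleteSpace B]

/-- Conjugation is a continuous ring homomorphism, so it commutes with the exponential, and it sends
`ic` to `-ic`. -/
theorem conj_expI (c : B) : Complexification.conj (expI c) = expI (-c) := by
  have h : Complexification.conj (Complex.I • toComplexification c : ComplexUnitization B) =
      Complex.I • toComplexification (-c) := by
    ext1 <;> simp [toComplexification]
  rw [expI, expI, ← h]
  exact NormedSpace.map_exp (Complexification.conj : ComplexUnitization B →+* _)
    Complexification.continuous_conj _

/-- The character of `B₊` vanishing on `B`, extended to the complexification, kills `ic` and so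
sends `e^{ic}` to `1`. Hence `sin c`, the imaginary part, lies in `B` itself even when `B` has no
identity. -/
theorem fst_im_expI (c : B) : (WithLp.ofLp (expI c).im).fst = 0 := by
  have h0 : Complexification.character AdjoinOne.fstHom
      (Complex.I • toComplexification c : ComplexUnitization B) = 0 := by
    apply Complex.ext <;> simp [toComplexification]
  have h1 : Complexification.character AdjoinOne.fstHom (expI c) = 1 := by
    rw [expI, NormedSpace.map_exp (Complexification.character (AdjoinOne.fstHom (B := B)))
      (Complexification.continuous_character _ AdjoinOne.norm_fstHom_le), h0,
      NormedSpace.exp_zero]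
  exact congrArg Complex.im h1

theorem expI_sub_expI_neg (c : B) :
    expI c - expI (-c) =
      (2 * Complex.I) • toComplexification (WithLp.ofLp (expI c).im).snd := by
  rw [← conj_expI, toComplexification, ← AdjoinOne.eq_inr_of_fst_eq_zero (fst_im_expI c)]
  ext1
  · simp
  · simp [two_smul]

/-- In a real Banach algebra every small element is the sine of an element. -/
theorem exists_expI_sub_expI_neg_eq :
    ∃ r : ℝ, 0 < r ∧ ∀ b : B, ‖b‖ < r → ∃ c : B,
      expI c - expI (-c) = (2 * Complex.I) • toComplexification b := by
  let l : B →L[ℝ] ComplexUnitization B :=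
    (Complexification.complexSMul Complex.I).comp toComplexificationCLM
  -- With this projection, `p (expI c)` is `sin c`.
  let p : ComplexUnitization B →L[ℝ] B := AdjoinOne.sndCLM.comp Complexification.imCLM
  have hexp : HasStrictFDerivAt (NormedSpace.exp : ComplexUnitization B → ComplexUnitization B)
      (1 : ComplexUnitization B →L[ℝ] ComplexUnitization B) (l 0) := by
    rw [map_zero]
    exact hasStrictFDerivAt_exp_zero
  have hS : HasStrictFDerivAt (fun c : B => p (expI c)) (p.comp ((1 : _ →L[ℝ] _).comp l)) 0 :=
    p.hasStrictFDerivAt.comp 0 (hexp.comp 0 l.hasStrictFDerivAt)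
  have hid : p.comp ((1 : _ →L[ℝ] _).comp l) = ContinuousLinearMap.id ℝ B := by
    ext b
    simp [p, l, toComplexification]
  rw [hid] at hS
  -- The strict derivative of the sine at `0` is the identity, so its range is a neighbourhood of
  -- `0`.
  have hmap := hS.map_nhds_eq_of_surj (LinearMap.range_eq_top.2 Function.surjective_id)
  have h0 : p (expI (0 : B)) = 0 := by
    have : toComplexification (0 : B) = 0 := map_zero toComplexificationCLM
    simp [p, expI, this, NormedSpace.exp_zero]
  rw [h0] at hmap
  have hrange : Set.range (fun c : B => p (expI c)) ∈ 𝓝 (0 : B) := by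
    rw [← hmap]
    exact Filter.range_mem_map
  obtain ⟨r, hr, hsub⟩ := Metric.mem_nhds_iff.1 hrange
  refine ⟨r, hr, fun b hb => ?_⟩
  obtain ⟨c, hc⟩ := hsub (mem_ball_zero_iff.2 hb)
  refine ⟨c, ?_⟩
  rw [expI_sub_expI_neg, ← hc]
  rfl

end Sine

end PolynomialGrowth

/-! ### Submultiplicative seminorms on the smooth functions -/

namespace SmoothFunctions

variable {n : ℕ}

theorem contDiff (f : SmoothFunctions n) : ContDiff ℝ ∞ f :=
  f.contMDiff.contDiff

/-- A smooth function as an element of `C^∞(ℝⁿ)`. -/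
def ofContDiff (f : EuclideanSpace ℝ (Fin n) → ℝ) (hf : ContDiff ℝ ∞ f) : SmoothFunctions n :=
  ⟨f, hf.contMDiff⟩

@[simp] theorem coe_ofContDiff (f : EuclideanSpace ℝ (Fin n) → ℝ) (hf : ContDiff ℝ ∞ f) :
    (ofContDiff f hf : EuclideanSpace ℝ (Fin n) → ℝ) = f := rfl

/-- The `k`-th derivative of a smooth function, as a continuous map. -/
def iteratedDerivative (n k : ℕ) : SmoothFunctions n →ₗ[ℝ]
    C(EuclideanSpace ℝ (Fin n), EuclideanSpace ℝ (Fin n) [×k]→L[ℝ] ℝ) where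
  toFun f := ⟨iteratedFDeriv ℝ k f, f.contDiff.continuous_iteratedFDeriv (mod_cast le_top)⟩
  map_add' f g := by
    ext1 x
    exact iteratedFDeriv_add_apply (f.contDiff.of_le (mod_cast le_top)).contDiffAt
      (g.contDiff.of_le (mod_cast le_top)).contDiffAt
  map_smul' c f := by
    ext1 x
    exact iteratedFDeriv_const_smul_apply (f.contDiff.of_le (mod_cast le_top)).contDiffAt

@[simp] theorem iteratedDerivative_apply (k : ℕ) (f : SmoothFunctions n)
    (x : EuclideanSpace ℝ (Fin n)) :
    iteratedDerivative n k f x = iteratedFDeriv ℝ k f x := rfl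

/-- Families of continuous fields of `k`-linear forms, `k ≤ N`, on the ball of radius `N`. -/
def JetSpace (n N : ℕ) : Type := (k : Fin (N + 1)) →
  C(Metric.closedBall (0 : EuclideanSpace ℝ (Fin n)) N, EuclideanSpace ℝ (Fin n) [×k]→L[ℝ] ℝ)

instance (n N : ℕ) : NormedAddCommGroup (JetSpace n N) :=
  inferInstanceAs (NormedAddCommGroup ((k : Fin (N + 1)) →
    C(Metric.closedBall (0 : EuclideanSpace ℝ (Fin n)) N, EuclideanSpace ℝ (Fin n) [×k]→L[ℝ] ℝ)))

instance (n N : ℕ) : NormedSpace ℝ (JetSpace n N) :=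
  inferInstanceAs (NormedSpace ℝ ((k : Fin (N + 1)) →
    C(Metric.closedBall (0 : EuclideanSpace ℝ (Fin n)) N, EuclideanSpace ℝ (Fin n) [×k]→L[ℝ] ℝ)))

/-- The derivatives of order at most `N` on the ball of radius `N`. -/
def jet (n N : ℕ) : SmoothFunctions n →ₗ[ℝ] JetSpace n N where
  toFun f k := (iteratedDerivative n k f).restrict _
  map_add' f g := by
    funext k
    rw [map_add]
    rfl
  map_smul' c f := by
    funext k
    rw [map_smul]
    rfl

theorem norm_iteratedFDeriv_le_norm_jet {N k : ℕ} (hk : k ≤ N) (f : SmoothFunctions n)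
    {x : EuclideanSpace ℝ (Fin n)} (hx : ‖x‖ ≤ N) :
    ‖iteratedFDeriv ℝ k f x‖ ≤ ‖jet n N f‖ :=
  ((jet n N f ⟨k, Nat.lt_succ_of_le hk⟩).norm_coe_le_norm
    ⟨x, mem_closedBall_zero_iff.2 hx⟩).trans
    (norm_le_pi_norm (G := fun k : Fin (N + 1) =>
      C(Metric.closedBall (0 : EuclideanSpace ℝ (Fin n)) N,
      EuclideanSpace ℝ (Fin n) [×k]→L[ℝ] ℝ)) (jet n N f) _)

theorem norm_jet_le {N : ℕ} (f : SmoothFunctions n) {c : ℝ} (hc : 0 ≤ c)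
    (h : ∀ k ≤ N, ∀ x : EuclideanSpace ℝ (Fin n), ‖x‖ ≤ N → ‖iteratedFDeriv ℝ k f x‖ ≤ c) :
    ‖jet n N f‖ ≤ c :=
  (pi_norm_le_iff_of_nonneg hc).2 fun k => (ContinuousMap.norm_le _ hc).2 fun x =>
    h k (Nat.le_of_lt_succ k.2) x (mem_closedBall_zero_iff.1 x.2)

/-- The submultiplicative seminorm `2 ^ N * sup {‖D^k f x‖ | k ≤ N, ‖x‖ ≤ N}`. -/
def ringSeminorm (n N : ℕ) : RingSeminorm (SmoothFunctions n) where
  toFun f := 2 ^ N * ‖jet n N f‖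
  map_zero' := by simp
  add_le' f g := by
    rw [map_add, ← mul_add]
    gcongr
    exact norm_add_le _ _
  neg' f := by rw [map_neg, norm_neg]
  mul_le' f g := by
    -- The binomial coefficients in the Leibniz rule add up to `2 ^ k ≤ 2 ^ N`, which the second
    -- factor `2 ^ N` on the right absorbs.
    rw [mul_mul_mul_comm, mul_assoc]
    gcongr
    refine norm_jet_le _ (by positivity) fun k hk x hx => ?_
    calc ‖iteratedFDeriv ℝ k (fun y => f y * g y) x‖
        ≤ ∑ i ∈ Finset.range (k + 1), (k.choose i : ℝ) * ‖iteratedFDeriv ℝ i f x‖ *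
            ‖iteratedFDeriv ℝ (k - i) g x‖ :=
          norm_iteratedFDeriv_mul_le f.contDiff g.contDiff x (mod_cast le_top)
      _ ≤ ∑ i ∈ Finset.range (k + 1), (k.choose i : ℝ) * (‖jet n N f‖ * ‖jet n N g‖) := by
          refine Finset.sum_le_sum fun i hi => ?_
          rw [mul_assoc]
          have := Finset.mem_range_succ_iff.1 hi
          gcongr
          · exact norm_iteratedFDeriv_le_norm_jet (by omega) f hx
          · exact norm_iteratedFDeriv_le_norm_jet (by omega) g hx
      _ = 2 ^ k * (‖jet n N f‖ * ‖jet n N g‖) := by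
          rw [← Finset.sum_mul]
          congr 1
          exact_mod_cast Nat.sum_range_choose k
      _ ≤ 2 ^ N * (‖jet n N f‖ * ‖jet n N g‖) := by
          gcongr
          norm_num

end SmoothFunctions

/-- The algebra `C^∞(ℝⁿ)` with the seminorm measuring the derivatives of order at most `N` on the
ball of radius `N`. -/
def SeminormedSmooth (n _N : ℕ) : Type := SmoothFunctions n

namespace SeminormedSmooth

variable {n N : ℕ}

instance : SeminormedCommRing (SeminormedSmooth n N) :=
  { (SmoothFunctions.ringSeminorm n N).toSeminormedRing with
    mul_comm := fun f g => mul_comm (G := SmoothFunctions n) f g }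

instance : Algebra ℝ (SeminormedSmooth n N) := inferInstanceAs (Algebra ℝ (SmoothFunctions n))

end SeminormedSmooth

namespace SmoothFunctions

/-- The identity map to the seminormed algebra. -/
def toSeminormed (n N : ℕ) : SmoothFunctions n ≃ₐ[ℝ] SeminormedSmooth n N := AlgEquiv.refl

variable {n N : ℕ}

theorem norm_toSeminormed (f : SmoothFunctions n) :
    ‖toSeminormed n N f‖ = 2 ^ N * ‖jet n N f‖ := rfl

theorem norm_jet_le_norm (f : SmoothFunctions n) : ‖jet n N f‖ ≤ ‖toSeminormed n N f‖ := by
  rw [norm_toSeminormed]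
  exact le_mul_of_one_le_left (norm_nonneg _) (one_le_pow₀ one_le_two)

end SmoothFunctions

namespace SeminormedSmooth

variable {n N : ℕ}

instance : NormedAlgebra ℝ (SeminormedSmooth n N) where
  norm_smul_le c f := by
    obtain ⟨f, rfl⟩ := (SmoothFunctions.toSeminormed n N).surjective f
    rw [← map_smul, SmoothFunctions.norm_toSeminormed, SmoothFunctions.norm_toSeminormed,
      map_smul, norm_smul]
    exact (mul_left_comm _ _ _).le

end SeminormedSmooth

namespace SmoothFunctions

variable {n N : ℕ}

theorem norm_iteratedFDeriv_le {k : ℕ} (hk : k ≤ N) (f : SmoothFunctions n)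
    {x : EuclideanSpace ℝ (Fin n)} (hx : ‖x‖ ≤ N) :
    ‖iteratedFDeriv ℝ k f x‖ ≤ ‖toSeminormed n N f‖ :=
  (norm_iteratedFDeriv_le_norm_jet hk f hx).trans (norm_jet_le_norm f)

theorem norm_toSeminormed_le (f : SmoothFunctions n) {c : ℝ} (hc : 0 ≤ c)
    (h : ∀ k ≤ N, ∀ x : EuclideanSpace ℝ (Fin n), ‖x‖ ≤ N → ‖iteratedFDeriv ℝ k f x‖ ≤ c) :
    ‖toSeminormed n N f‖ ≤ 2 ^ N * c := by
  rw [norm_toSeminormed]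
  gcongr
  exact norm_jet_le f hc h

theorem norm_toSeminormed_mono {M : ℕ} (h : M ≤ N) (f : SmoothFunctions n) :
    ‖toSeminormed n M f‖ ≤ ‖toSeminormed n N f‖ := by
  rw [norm_toSeminormed, norm_toSeminormed]
  gcongr
  · norm_num
  · exact norm_jet_le f (norm_nonneg _) fun k hk x hx =>
      norm_iteratedFDeriv_le_norm_jet (hk.trans h) f (hx.trans (mod_cast h))

/-! ### The topology -/

theorem exists_nat_ge_and_ge (R : ℝ) (k : ℕ) : ∃ N : ℕ, R ≤ N ∧ k ≤ N := by
  obtain ⟨N, hN⟩ := exists_nat_ge R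
  exact ⟨max N k, hN.trans (mod_cast le_max_left N k), le_max_right N k⟩

theorem continuous_iteratedDerivative (k : ℕ) : Continuous (iteratedDerivative n k) := by
  rw [ContinuousMap.continuous_iff_continuous_uniformOnFun]
  exact continuous_iInf_dom (i := k) continuous_induced_dom

theorem continuous_jet (N : ℕ) : Continuous (jet n N) :=
  continuous_pi fun k : Fin (N + 1) =>
    (ContinuousMap.continuous_restrict _).comp (continuous_iteratedDerivative (n := n) k)

theorem continuous_toSeminormed (N : ℕ) : Continuous (toSeminormed n N) := by
  have hjet : Continuous (jet n N) := continuous_jet N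
  refine continuous_iff_continuousAt.2 fun f => tendsto_iff_norm_sub_tendsto_zero.2 ?_
  have h : Filter.Tendsto (fun g => 2 ^ N * ‖jet n N g - jet n N f‖) (𝓝 f) (𝓝 0) := by
    simpa using (tendsto_iff_norm_sub_tendsto_zero.1 (hjet.tendsto f)).const_mul (2 ^ N)
  refine h.congr fun g => ?_
  rw [← map_sub, ← map_sub, norm_toSeminormed]

/-- A compact set and an order of differentiation are both dominated by a single `N`, so this
countable family of seminorms suffices. -/
theorem topology_eq_iInf : SmoothFunctions.instTopologicalSpace n =
    ⨅ N, TopologicalSpace.induced (toSeminormed n N) inferInstance := by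
  refine le_antisymm (le_iInf fun N => (continuous_toSeminormed N).le_induced) ?_
  refine le_iInf fun k => ?_
  refine continuous_iff_le_induced.1 ?_
  refine (@ContinuousMap.continuous_iff_continuous_uniformOnFun _ _ _ _ (SmoothFunctions n)
    (⨅ N, TopologicalSpace.induced (toSeminormed n N) inferInstance)
    (iteratedDerivative n k)).1 ?_
  rw [ContinuousMap.compactOpen_eq_iInf_induced]
  refine continuous_iInf_rng.2 fun K => continuous_iInf_rng.2 fun hK => continuous_induced_rng.2 ?_
  obtain ⟨R, hR⟩ := hK.isBounded.subset_closedBall (0 : EuclideanSpace ℝ (Fin n))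
  obtain ⟨N, hRN, hkN⟩ := exists_nat_ge_and_ge R k
  have : CompactSpace K := isCompact_iff_compactSpace.1 hK
  have hlin : Continuous (fun f : SeminormedSmooth n N =>
      (iteratedDerivative n k ((toSeminormed n N).symm f)).restrict K) := by
    let l : SeminormedSmooth n N →ₗ[ℝ] C(K, EuclideanSpace ℝ (Fin n) [×k]→L[ℝ] ℝ) :=
      { toFun := fun f => (iteratedDerivative n k ((toSeminormed n N).symm f)).restrict K
        map_add' := fun f g => by rw [map_add, map_add]; rfl
        map_smul' := fun c f => by rw [map_smul, map_smul]; rfl }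
    refine AddMonoidHomClass.continuous_of_bound l 1 fun f => ?_
    rw [one_mul]
    refine (ContinuousMap.norm_le _ (norm_nonneg _)).2 fun x => ?_
    exact norm_iteratedFDeriv_le hkN
      ((toSeminormed n N).symm f)
      ((mem_closedBall_zero_iff.1 (hR x.2)).trans hRN)
  exact continuous_iInf_dom (i := N) (@Continuous.comp _ _ _
    (TopologicalSpace.induced (toSeminormed n N) inferInstance) _ _ (toSeminormed n N) _ hlin
    continuous_induced_dom)

/-! ### Completeness -/

/-- Derivatives of every order converge locally uniformly, and a locally uniform limit of
derivatives is the derivative of the limit. -/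
theorem exists_limit (f : ℕ → SmoothFunctions n)
    (hf : ∀ N, CauchySeq fun m => toSeminormed n N (f m)) :
    ∃ g : SmoothFunctions n, ∀ N,
      Filter.Tendsto (fun m => toSeminormed n N (f m)) Filter.atTop (𝓝 (toSeminormed n N g)) := by
  have hcauchy (k N : ℕ) (hk : k ≤ N) : UniformCauchySeqOn (fun m => iteratedFDeriv ℝ k (f m))
      Filter.atTop (Metric.closedBall 0 N) := by
    rw [Metric.uniformCauchySeqOn_iff]
    intro ε hε
    obtain ⟨m₀, h⟩ := Metric.cauchySeq_iff.1 (hf N) ε hε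
    refine ⟨m₀, fun m hm m' hm' x hx => lt_of_le_of_lt ?_ (h m hm m' hm')⟩
    rw [dist_eq_norm, dist_eq_norm, ← map_sub]
    refine le_trans (le_of_eq ?_)
      (norm_iteratedFDeriv_le hk (f m - f m') (mem_closedBall_zero_iff.1 hx))
    exact congrArg norm (DFunLike.congr_fun (map_sub (iteratedDerivative n k) (f m) (f m')) x).symm
  have hlim (k : ℕ) (x : EuclideanSpace ℝ (Fin n)) :
      ∃ y, Filter.Tendsto (fun m => iteratedFDeriv ℝ k (f m) x) Filter.atTop (𝓝 y) := by
    obtain ⟨N, hRN, hkN⟩ := exists_nat_ge_and_ge ‖x‖ k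
    exact cauchySeq_tendsto_of_complete ((hcauchy k N hkN).cauchySeq
      (mem_closedBall_zero_iff.2 hRN))
  choose p hp using fun x k => hlim k x
  have hunif (k N : ℕ) (hk : k ≤ N) : TendstoUniformlyOn (fun m => iteratedFDeriv ℝ k (f m))
      (fun x => p x k) Filter.atTop (Metric.closedBall 0 N) :=
    (hcauchy k N hk).tendstoUniformlyOn_of_tendsto fun x _ => hp x k
  have hloc (k : ℕ) : TendstoLocallyUniformly (fun m => iteratedFDeriv ℝ k (f m))
      (fun x => p x k) Filter.atTop := by
    rw [tendstoLocallyUniformly_iff_forall_isCompact]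
    intro K hK
    obtain ⟨R, hR⟩ := hK.isBounded.subset_closedBall (0 : EuclideanSpace ℝ (Fin n))
    obtain ⟨N, hRN, hkN⟩ := exists_nat_ge_and_ge R k
    exact (hunif k N hkN).mono
      (hR.trans (Metric.closedBall_subset_closedBall hRN))
  -- The limits of the derivatives form a Taylor series, which gives smoothness of the limit and
  -- identifies its derivatives at once.
  have htaylor : HasFTaylorSeriesUpTo ∞ (fun x => (p x 0).curry0) p := by
    refine ⟨fun x => rfl, fun k _ x => ?_, fun k _ => ?_⟩
    · refine hasFDerivAt_of_tendstoLocallyUniformlyOn (l := Filter.atTop)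
        (f := fun m => iteratedFDeriv ℝ k (f m))
        (f' := fun m x => (iteratedFDeriv ℝ (k + 1) (f m) x).curryLeft)
        (g' := fun x => (p x (k + 1)).curryLeft) isOpen_univ ?_ ?_ (fun x _ => hp x k)
        (Set.mem_univ x)
      · rw [tendstoLocallyUniformlyOn_univ]
        exact (continuousMultilinearCurryLeftEquiv ℝ (fun _ : Fin (k + 1) =>
          EuclideanSpace ℝ (Fin n)) ℝ).isometry.uniformContinuous.comp_tendstoLocallyUniformly
            (hloc (k + 1))
      · intro m y _
        have := ((f m).contDiff.ftaylorSeries (n := ∞)).fderiv k (mod_cast WithTop.coe_lt_top _) y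
        exact this
    · exact (hloc k).continuous (Filter.Frequently.of_forall fun m =>
        (f m).contDiff.continuous_iteratedFDeriv (mod_cast le_top))
  refine ⟨ofContDiff _ htaylor.contDiff, fun N => ?_⟩
  rw [Metric.tendsto_atTop]
  intro ε hε
  have hev : ∀ᶠ m in Filter.atTop, ∀ k ∈ Finset.range (N + 1), ∀ x ∈ Metric.closedBall 0 (N : ℝ),
      dist (p x k) (iteratedFDeriv ℝ k (f m) x) < ε / 2 ^ (N + 1) :=
    (Filter.eventually_all_finset _).2 fun k hk =>
      Metric.tendstoUniformlyOn_iff.1 (hunif k N (Finset.mem_range_succ_iff.1 hk)) _ (by positivity)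
  obtain ⟨m₀, h⟩ := Filter.eventually_atTop.1 hev
  refine ⟨m₀, fun m hm => ?_⟩
  rw [dist_eq_norm, ← map_sub]
  -- The denominator `2 ^ (N + 1)` cancels the weight `2 ^ N` of the seminorm and leaves `ε / 2`, so
  -- that the inequality is strict.
  refine lt_of_le_of_lt (norm_toSeminormed_le _ (c := ε / 2 ^ (N + 1)) (by positivity)
    fun k hk x hx => ?_) (?_ : 2 ^ N * (ε / 2 ^ (N + 1)) < ε)
  · have hd := (h m hm k (Finset.mem_range_succ_iff.2 hk) x (mem_closedBall_zero_iff.2 hx)).le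
    rw [dist_comm, dist_eq_norm, htaylor.eq_iteratedFDeriv (mod_cast le_top) x] at hd
    refine le_trans (le_of_eq ?_) hd
    exact congrArg norm (DFunLike.congr_fun (map_sub (iteratedDerivative n k) (f m) _) x)
  · rw [pow_succ]
    field_simp
    norm_num

end SmoothFunctions

/-- The Banach algebra completing `C^∞(ℝⁿ)` with respect to the derivatives of order at most `N` on
the ball of radius `N`. -/
abbrev SmoothCompletion (n N : ℕ) : Type := UniformSpace.Completion (SeminormedSmooth n N)

/-! ### Sine and cosine series in the Banach completions -/

namespace SmoothFunctions

variable {n : ℕ}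

/-- The natural map to the completion. -/
def toCompletion (n N : ℕ) : SmoothFunctions n →ₐ[ℝ] SmoothCompletion n N :=
  AlgHom.ofLinearMap
    { toFun := fun f => (toSeminormed n N f : SmoothCompletion n N)
      map_add' := fun f g => by rw [map_add, UniformSpace.Completion.coe_add]
      map_smul' := fun c f => by
        rw [map_smul, UniformSpace.Completion.coe_smul, RingHom.id_apply] }
    (UniformSpace.Completion.coe_one (SeminormedSmooth n N))
    fun f g => by
      change ((toSeminormed n N (f * g) : SeminormedSmooth n N) : SmoothCompletion n N) = _
      rw [map_mul, UniformSpace.Completion.coe_mul]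
      rfl

theorem norm_toCompletion {N : ℕ} (f : SmoothFunctions n) :
    ‖toCompletion n N f‖ = ‖toSeminormed n N f‖ :=
  UniformSpace.Completion.norm_coe _

theorem abs_apply_le {N : ℕ} (f : SmoothFunctions n) {x : EuclideanSpace ℝ (Fin n)}
    (hx : ‖x‖ ≤ N) : |f x| ≤ ‖toSeminormed n N f‖ := by
  simpa using norm_iteratedFDeriv_le (Nat.zero_le N) f hx

theorem denseRange_toCompletion (N : ℕ) : DenseRange (toCompletion n N) :=
  UniformSpace.Completion.denseRange_coe.comp (toSeminormed n N).surjective.denseRange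
    (UniformSpace.Completion.continuous_coe _)

/-- Evaluation at a point. -/
def evalAddHom (x : EuclideanSpace ℝ (Fin n)) : SmoothFunctions n →+ ℝ where
  toFun f := f x
  map_zero' := rfl
  map_add' _ _ := rfl

/-- Absolute convergence in all completions yields a smooth limit of the partial sums; evaluations
are dominated by the seminorms, so the pointwise sums identify it with `g`. -/
theorem hasSum_toCompletion (a : ℕ → SmoothFunctions n) (g : SmoothFunctions n)
    (ha : ∀ N, Summable fun k => ‖toCompletion n N (a k)‖)
    (hg : ∀ x, HasSum (fun k => a k x) (g x)) (N : ℕ) :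
    HasSum (fun k => toCompletion n N (a k)) (toCompletion n N g) := by
  obtain ⟨g', hg'⟩ := exists_limit (fun m => ∑ k ∈ Finset.range m, a k) fun N => by
    simp only [map_sum]
    simp only [norm_toCompletion] at ha
    exact cauchySeq_range_of_norm_bounded (ha N).hasSum.tendsto_sum_nat.cauchySeq fun _ => le_rfl
  have hgg' : g' = g := by
    ext x
    obtain ⟨N, hN⟩ := exists_nat_ge ‖x‖
    refine tendsto_nhds_unique ?_ (hg x).tendsto_sum_nat
    refine tendsto_iff_norm_sub_tendsto_zero.2 (squeeze_zero (fun _ => norm_nonneg _) (fun m => ?_)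
      (tendsto_iff_norm_sub_tendsto_zero.1 (hg' N)))
    rw [← map_sub]
    refine le_trans (le_of_eq ?_) (abs_apply_le _ hN)
    rw [Real.norm_eq_abs]
    congr 1
    exact congrArg (· - g' x) (map_sum (evalAddHom x) a (Finset.range m)).symm
  rw [(ha N).of_norm.hasSum_iff_tendsto_nat]
  rw [← hgg']
  simp only [← map_sum]
  exact (UniformSpace.Completion.continuous_coe _).continuousAt.tendsto.comp (hg' N)

/-- The function `cos ∘ f`. -/
def cos (f : SmoothFunctions n) : SmoothFunctions n :=
  ofContDiff (fun x => Real.cos (f x)) (Real.contDiff_cos.comp f.contDiff)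

/-- The function `sin ∘ f`. -/
def sin (f : SmoothFunctions n) : SmoothFunctions n :=
  ofContDiff (fun x => Real.sin (f x)) (Real.contDiff_sin.comp f.contDiff)

theorem pow_apply (f : SmoothFunctions n) (k : ℕ) (x) : (f ^ k) x = f x ^ k := by
  induction k with
  | zero => rfl
  | succ k ih => rw [pow_succ, pow_succ, ← ih]; rfl

theorem hasSum_cos (f : SmoothFunctions n) (N : ℕ) :
    HasSum (fun k : ℕ => ((-1) ^ k / (2 * k).factorial : ℝ) • toCompletion n N f ^ (2 * k))
      (toCompletion n N (cos f)) := by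
  have := hasSum_toCompletion (fun k : ℕ => ((-1) ^ k / (2 * k).factorial : ℝ) • f ^ (2 * k))
    (cos f) (fun N => ?_) (fun x => ?_) N
  · simpa using this
  -- Absolute convergence is inherited from the even terms of the exponential series.
  · have := (NormedSpace.norm_expSeries_summable' (𝕂 := ℝ) (toCompletion n N f)).comp_injective
      (mul_right_injective₀ (two_ne_zero (α := ℕ)))
    refine this.congr fun k => ?_
    simp [norm_smul]
  · convert Real.hasSum_cos (f x) using 2 with k
    change ((-1) ^ k / (2 * k).factorial : ℝ) * (f ^ (2 * k)) x = _
    rw [pow_apply]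
    · ring
    · rfl

theorem hasSum_sin (f : SmoothFunctions n) (N : ℕ) :
    HasSum (fun k : ℕ => ((-1) ^ k / (2 * k + 1).factorial : ℝ) • toCompletion n N f ^ (2 * k + 1))
      (toCompletion n N (sin f)) := by
  have := hasSum_toCompletion
    (fun k : ℕ => ((-1) ^ k / (2 * k + 1).factorial : ℝ) • f ^ (2 * k + 1))
    (sin f) (fun N => ?_) (fun x => ?_) N
  · simpa using this
  · have := (NormedSpace.norm_expSeries_summable' (𝕂 := ℝ) (toCompletion n N f)).comp_injective
      (i := fun k : ℕ => 2 * k + 1) (fun a b h => by simpa using h)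
    refine this.congr fun k => ?_
    simp [norm_smul]
  · convert Real.hasSum_sin (f x) using 2 with k
    change ((-1) ^ k / (2 * k + 1).factorial : ℝ) * (f ^ (2 * k + 1)) x = _
    rw [pow_apply]
    · ring
    · rfl

/-- This is the Faà di Bruno estimate for `g ∘ (s • f)`. The exponent of `1 + |s|` does not depend
on `f`, and `f` enters only through its norm, so the estimate survives passage to the completion. -/
theorem norm_toCompletion_comp_smul_le (N : ℕ) (f h : SmoothFunctions n) (g : ℝ → ℝ)
    (hg : ContDiff ℝ ∞ g) (hbound : ∀ i x, |iteratedDeriv i g x| ≤ 1) (s : ℝ)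
    (hh : ∀ x, h x = g (s * f x)) :
    ‖toCompletion n N h‖ ≤
      2 ^ N * (N.factorial * ((1 + |s|) * (1 + ‖toCompletion n N f‖)) ^ N) := by
  rw [norm_toCompletion, norm_toCompletion]
  set q := ‖toSeminormed n N f‖ with hq
  have hq0 : 0 ≤ q := norm_nonneg _
  -- Since this number is at least `1`, a bound by it on the `i`-th derivative of `s • f`, `i ≥ 1`,
  -- is also a bound by its `i`-th power, as the Faà di Bruno estimate requires.
  have hD : 1 ≤ (1 + |s|) * (1 + q) := by nlinarith [abs_nonneg s, mul_nonneg (abs_nonneg s) hq0]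
  refine norm_toSeminormed_le _ (by positivity) fun k hk x hx => ?_
  have hcomp : (h : EuclideanSpace ℝ (Fin n) → ℝ) = g ∘ (s • f : SmoothFunctions n) := by
    funext y
    exact hh y
  rw [hcomp]
  refine (norm_iteratedFDeriv_comp_le (n := k) (C := 1) (D := (1 + |s|) * (1 + q)) hg
    (s • f).contDiff (mod_cast le_top) x (fun i _ => ?_) fun i hi hik => ?_).trans ?_
  · rw [norm_iteratedFDeriv_eq_norm_iteratedDeriv]
    exact hbound i _
  · refine le_trans ?_ (le_self_pow₀ hD (by omega))
    refine (norm_iteratedFDeriv_le (hik.trans hk) _ hx).trans ?_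
    rw [map_smul, norm_smul, Real.norm_eq_abs]
    exact mul_le_mul (by simp) (by simp [hq]) (norm_nonneg _) (by positivity)
  · rw [mul_one]
    gcongr

end SmoothFunctions

/-! ### Polynomial growth of the completions, and their projective limit -/

section PolynomialGrowth

variable {B : Type u} [NonUnitalNormedRing B] [NormedSpace ℝ B] [IsScalarTower ℝ B B]
  [SMulCommClass ℝ B B]

theorem I_mul_smul_toComplexification (s : ℝ) (b : B) :
    (Complex.I * (s : ℂ)) • toComplexification b = Complex.I • toComplexification (s • b) := by
  rw [mul_smul, ← toComplexificationHom_apply, ← toComplexificationHom_apply, map_smul]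
  rfl

theorem isOfPolynomialGrowth_iff_expI (b : B) : IsOfPolynomialGrowth b ↔
    ∃ K : ℝ, 0 < K ∧ ∃ α : ℝ, 0 ≤ α ∧ ∀ s : ℝ, ‖expI (s • b)‖ ≤ K * (1 + |s|) ^ α := by
  simp only [IsOfPolynomialGrowth, I_mul_smul_toComplexification, expI]

end PolynomialGrowth

theorem continuous_expI {B : Type u} [NonUnitalNormedRing B] [NormedSpace ℝ B]
    [IsScalarTower ℝ B B] [SMulCommClass ℝ B B] [CompleteSpace B] :
    Continuous (expI : B → ComplexUnitization B) :=
  NormedSpace.exp_continuous.comp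
    ((Complexification.complexSMul Complex.I).continuous.comp toComplexificationCLM.continuous)

theorem HasSum.congr_terms {E : Type u} [AddCommMonoid E] [TopologicalSpace E] {f g : ℕ → E}
    {a : E} (h : HasSum g a) (hfg : ∀ k, f k = g k) : HasSum f a := by
  rwa [funext hfg]

/-- Euler's formula in a unital algebra `B`: the exponential is determined by its cosine and sine
series in `B`. -/
theorem expI_eq_of_hasSum {B : Type u} [NormedRing B] [NormedAlgebra ℝ B] [CompleteSpace B]
    {b c s : B}
    (hc : HasSum (fun k : ℕ => ((-1) ^ k / (2 * k).factorial : ℝ) • b ^ (2 * k)) c)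
    (hs : HasSum (fun k : ℕ => ((-1) ^ k / (2 * k + 1).factorial : ℝ) • b ^ (2 * k + 1)) s) :
    expI b = 1 + toComplexification (c - 1) + Complex.I • toComplexification s := by
  set x : ComplexUnitization B := Complex.I • toComplexification b with hx
  -- The identity of `B` becomes an idempotent `e` distinct from the adjoined identity. As `x * (1 -
  -- e) = 0`, the exponential is `1 - e` on one summand and the usual Euler series on the other.
  set e : ComplexUnitization B := toComplexification 1 with he
  have hmul (a b : B) : (toComplexification a * toComplexification b : ComplexUnitization B) =
      toComplexification (a * b) := (map_mul toComplexificationHom a b).symm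
  have hexp : HasSum (fun k : ℕ => (k.factorial⁻¹ : ℝ) • x ^ k) (expI b) :=
    NormedSpace.exp_series_hasSum_exp' x
  have hxe : x * (1 - e) = 0 := by
    rw [hx, mul_sub, mul_one, smul_mul_assoc, he, hmul, mul_one, sub_self]
  have hpow (k : ℕ) : x ^ k * e = Complex.I ^ k • toComplexification (b ^ k) := by
    induction k with
    | zero => simp [he]
    | succ k ih => rw [pow_succ', mul_assoc, ih, hx, smul_mul_smul_comm, hmul, pow_succ', pow_succ']
  have h1 : expI b * (1 - e) = 1 - e := by
    refine (hexp.mul_right (1 - e)).unique ?_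
    have := hasSum_single (f := fun k : ℕ => (k.factorial⁻¹ : ℝ) • x ^ k * (1 - e)) 0
      fun k hk => by
        obtain ⟨m, rfl⟩ := Nat.exists_eq_succ_of_ne_zero hk
        rw [pow_succ, smul_mul_assoc, mul_assoc, hxe, mul_zero, smul_zero]
    simpa only [Nat.factorial_zero, Nat.cast_one, inv_one, one_smul, pow_zero, one_mul] using this
  have hreal (r : ℝ) (a : B) : (r • toComplexification a : ComplexUnitization B) =
    toComplexification (r • a) := (map_smul toComplexificationHom r a).symm
  have hcast (r : ℝ) (z : ComplexUnitization B) : r • z = (r : ℂ) • z := rfl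
  have h2 : expI b * e = toComplexification c + Complex.I • toComplexification s := by
    refine (hexp.mul_right e).unique (HasSum.even_add_odd ?_ ?_)
    · refine (toComplexificationCLM.hasSum hc).congr_terms fun k => ?_
      rw [smul_mul_assoc, hpow, toComplexificationCLM_apply, ← hreal]
      rw [hcast, hcast, smul_smul, pow_mul, Complex.I_sq]
      congr 1
      push_cast
      ring
    · refine ((Complexification.complexSMul Complex.I).hasSum
        (toComplexificationCLM.hasSum hs)).congr_terms fun k => ?_
      rw [smul_mul_assoc, hpow, toComplexificationCLM_apply, ← hreal]
      rw [Complexification.complexSMul_apply, hcast, hcast, smul_smul, smul_smul,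
        pow_succ, pow_mul, Complex.I_sq]
      congr 1
      push_cast
      ring
  calc expI b = expI b * (1 - e) + expI b * e := by rw [← mul_add, sub_add_cancel, mul_one]
    _ = 1 + (toComplexification c - e) + Complex.I • toComplexification s := by
        rw [h1, h2]; abel
    _ = _ := by
        rw [he]
        congr 2
        exact (map_sub toComplexificationHom c 1).symm

namespace SmoothFunctions

variable {n : ℕ}

theorem norm_expI_smul_toCompletion_le (N : ℕ) (f : SmoothFunctions n) (s : ℝ) :
    ‖expI (s • toCompletion n N f)‖ ≤
      (1 + 2 ^ N * N.factorial + ‖(1 : SmoothCompletion n N)‖ + 2 ^ N * N.factorial) *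
        ((1 + |s|) * (1 + ‖toCompletion n N f‖)) ^ N := by
  have hcos : ‖toCompletion n N (cos (s • f))‖ ≤ _ := norm_toCompletion_comp_smul_le N f
    (cos (s • f)) Real.cos Real.contDiff_cos Real.abs_iteratedDeriv_cos_le_one s fun _ => rfl
  have hsin : ‖toCompletion n N (sin (s • f))‖ ≤ _ := norm_toCompletion_comp_smul_le N f
    (sin (s • f)) Real.sin Real.contDiff_sin Real.abs_iteratedDeriv_sin_le_one s fun _ => rfl
  have hI (z : ComplexUnitization (SmoothCompletion n N)) : ‖Complex.I • z‖ = ‖z‖ := by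
    simp [Complexification.norm_def, add_comm]
  set D := ((1 + |s|) * (1 + ‖toCompletion n N f‖)) ^ N
  have hD : 1 ≤ D := one_le_pow₀ (by
    nlinarith [abs_nonneg s, norm_nonneg (toCompletion n N f),
      mul_nonneg (abs_nonneg s) (norm_nonneg (toCompletion n N f))])
  rw [← map_smul, expI_eq_of_hasSum (hasSum_cos (s • f) N) (hasSum_sin (s • f) N)]
  refine (norm_add₃_le (E := ComplexUnitization (SmoothCompletion n N))).trans ?_
  rw [hI, norm_toComplexification, norm_toComplexification, ComplexUnitization.norm_one]
  have hsub := norm_sub_le (toCompletion n N (cos (s • f))) 1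
  nlinarith [norm_nonneg (1 : SmoothCompletion n N)]

/-- For fixed `s` both sides of the estimate are continuous in `b`, so it extends from the dense
image of the smooth functions. -/
theorem isPG_completion (n N : ℕ) : IsPG (SmoothCompletion n N) := by
  refine ⟨inferInstance, fun b => (isOfPolynomialGrowth_iff_expI b).2
    ⟨(1 + 2 ^ N * N.factorial + ‖(1 : SmoothCompletion n N)‖ + 2 ^ N * N.factorial) *
      (1 + ‖b‖) ^ N, by positivity, N, by positivity, fun s => ?_⟩⟩
  rw [Real.rpow_natCast, mul_assoc, ← mul_pow, mul_comm (1 + ‖b‖)]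
  refine (denseRange_toCompletion N).induction_on (p := fun b => ‖expI (s • b)‖ ≤ _ *
    ((1 + |s|) * (1 + ‖b‖)) ^ N) b (isClosed_le ?_ ?_)
    fun f => norm_expI_smul_toCompletion_le N f s
  · exact (continuous_norm (E := ComplexUnitization (SmoothCompletion n N))).comp
      (continuous_expI.comp (continuous_const_smul s))
  · fun_prop

/-- The linking maps between the completions. -/
def completionMap (n : ℕ) {M N : ℕ} (_h : M ≤ N) :
    SmoothCompletion n N →L[ℝ] SmoothCompletion n M :=
  (toCompletion n M).toLinearMap.extendOfNorm (toCompletion n N).toLinearMap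

@[simp] theorem completionMap_toCompletion {M N : ℕ} (h : M ≤ N) (f : SmoothFunctions n) :
    completionMap n h (toCompletion n N f) = toCompletion n M f :=
  LinearMap.extendOfNorm_eq (denseRange_toCompletion N) ⟨1, fun f => by
    rw [one_mul]
    exact (norm_toCompletion f).trans_le ((norm_toSeminormed_mono h f).trans_eq
      (norm_toCompletion f).symm)⟩ f

theorem completionMap_mul {M N : ℕ} (h : M ≤ N) (a b : SmoothCompletion n N) :
    completionMap n h (a * b) = completionMap n h a * completionMap n h b := by
  refine (denseRange_toCompletion N).induction_on₂ (p := fun a b =>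
    completionMap n h (a * b) = completionMap n h a * completionMap n h b)
    (isClosed_eq (by fun_prop) (by fun_prop)) (fun f g => ?_) a b
  rw [← map_mul, completionMap_toCompletion, completionMap_toCompletion,
    completionMap_toCompletion, map_mul]

/-- The projective system of the completions of `C^∞(ℝⁿ)`. -/
def system (n : ℕ) : PGSystem ℕ where
  obj N := SmoothCompletion n N
  isPG N := isPG_completion n N
  map h :=
    { toFun := completionMap n h
      map_smul' := (completionMap n h).map_smul
      map_zero' := (completionMap n h).map_zero
      map_add' := (completionMap n h).map_add
      map_mul' := completionMap_mul h }
  continuous_map h := (completionMap n h).continuous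
  map_self N x := by
    refine (denseRange_toCompletion N).induction_on (p := fun x => completionMap n le_rfl x = x) x
      (isClosed_eq (by fun_prop) (by fun_prop)) fun f => by simp
  map_map h h' x := by
    refine (denseRange_toCompletion _).induction_on (p := fun x =>
      completionMap n h (completionMap n h' x) = completionMap n (h.trans h') x) x
      (isClosed_eq (by fun_prop) (by fun_prop)) fun f => by simp

/-- The natural map of `C^∞(ℝⁿ)` to the projective limit of its completions. -/
def toLimit (n : ℕ) : SmoothFunctions n →ₙₐ[ℝ] (system n).limit where
  toFun f := ⟨fun N => toCompletion n N f, fun _ _ h => completionMap_toCompletion h f⟩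
  map_smul' c f := Subtype.ext (funext fun N => map_smul (toCompletion n N) c f)
  map_zero' := Subtype.ext (funext fun N => map_zero (toCompletion n N))
  map_add' f g := Subtype.ext (funext fun N => map_add (toCompletion n N) f g)
  map_mul' f g := Subtype.ext (funext fun N => map_mul (toCompletion n N) f g)

theorem eq_of_toCompletion_eq {f g : SmoothFunctions n}
    (h : ∀ N, toCompletion n N f = toCompletion n N g) : f = g := by
  ext x
  obtain ⟨N, hN⟩ := exists_nat_ge ‖x‖
  have h0 : ‖toSeminormed n N (f - g)‖ = 0 := by
    rw [← norm_toCompletion, map_sub, h N, sub_self, norm_zero]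
  have := abs_apply_le (f - g) hN
  rw [h0] at this
  exact sub_eq_zero.1 (abs_nonpos_iff.1 this)

/-- Choose smooth `f N` within `2⁻ᴺ` of `y N`. The linking maps are contractions, so the `f N`
converge to `y M` in every completion, and `exists_limit` supplies a smooth limit. -/
theorem exists_toCompletion_eq (y : (N : ℕ) → SmoothCompletion n N)
    (hy : ∀ M N (h : M ≤ N), completionMap n h (y N) = y M) :
    ∃ g, ∀ N, toCompletion n N g = y N := by
  have happrox (N : ℕ) : ∃ f, dist (y N) (toCompletion n N f) < (1 / 2) ^ N :=
    (denseRange_toCompletion N).exists_dist_lt (y N) (by positivity)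
  choose f hf using happrox
  have hdist (M : ℕ) {N : ℕ} (h : M ≤ N) : dist (y M) (toCompletion n M (f N)) ≤ (1 / 2) ^ N := by
    have hyM : y M = completionMap n h (y N) := (hy M N h).symm
    rw [hyM, ← completionMap_toCompletion h (f N), dist_eq_norm, ← map_sub]
    refine (LinearMap.norm_extendOfNorm_apply_le (denseRange_toCompletion N) 1 (fun f => ?_)
      _).trans ?_
    · rw [one_mul]
      exact (norm_toCompletion f).trans_le ((norm_toSeminormed_mono h f).trans_eq
        (norm_toCompletion f).symm)
    · rw [one_mul, ← dist_eq_norm]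
      exact (hf N).le
  have htend (M : ℕ) : Filter.Tendsto (fun N => toCompletion n M (f N)) Filter.atTop (𝓝 (y M)) := by
    refine tendsto_iff_dist_tendsto_zero.2 (squeeze_zero' (Filter.Eventually.of_forall fun _ =>
      dist_nonneg) ?_ (tendsto_pow_atTop_nhds_zero_of_lt_one (r := (1 / 2 : ℝ)) (by norm_num)
        (by norm_num)))
    filter_upwards [Filter.eventually_ge_atTop M] with N hN
    rw [dist_comm]
    exact hdist M hN
  obtain ⟨g, hg⟩ := exists_limit f fun M =>
    (UniformSpace.Completion.isUniformInducing_coe _).cauchy_map_iff.1 (htend M).cauchySeq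
  refine ⟨g, fun N => ?_⟩
  exact tendsto_nhds_unique
    ((UniformSpace.Completion.continuous_coe _).continuousAt.tendsto.comp (hg N)) (htend N)

theorem toLimit_surjective (n : ℕ) : Function.Surjective (toLimit n) := by
  rintro ⟨y, hy⟩
  obtain ⟨g, hg⟩ := exists_toCompletion_eq y hy
  exact ⟨g, Subtype.ext (funext hg)⟩

theorem isInducing_toLimit (n : ℕ) : Topology.IsInducing (toLimit n) := by
  constructor
  rw [topology_eq_iInf, instTopologicalSpaceSubtype, Pi.topologicalSpace, induced_iInf,
    induced_iInf]
  refine iInf_congr fun N => ?_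
  rw [(UniformSpace.Completion.isUniformInducing_coe (SeminormedSmooth n N)).isInducing.eq_induced,
    induced_compose, induced_compose, induced_compose]
  rfl

theorem isPGL (n : ℕ) : IsPGL (SmoothFunctions n) :=
  ⟨ℕ, inferInstance, inferInstance, inferInstance, system n, toLimit n,
    isHomeomorph_iff_isEmbedding_surjective.2 ⟨⟨isInducing_toLimit n, fun _ _ h =>
      eq_of_toCompletion_eq fun N => congrFun (congrArg Subtype.val h) N⟩, toLimit_surjective n⟩⟩

end SmoothFunctions

/-! ### Density of polynomials in the smooth functions -/

open MeasureTheory ContinuousLinearMap in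
-- All derivatives fall on the smooth factor `g`, so a kernel `κ` that is only uniformly close to a
-- mollifier still approximates every derivative.
theorem iteratedFDeriv_convolution_lsmul {V : Type u} [NormedAddCommGroup V]
    [NormedSpace ℝ V] [MeasurableSpace V] [BorelSpace V] {μ : Measure V} [SFinite μ]
    [μ.IsAddLeftInvariant] {g κ : V → ℝ}
    (hg : ContDiff ℝ ∞ g) (hgs : HasCompactSupport g) (hκ : LocallyIntegrable κ μ) (k : ℕ) :
    iteratedFDeriv ℝ k (convolution κ g (lsmul ℝ ℝ) μ) =
      convolution κ (iteratedFDeriv ℝ k g) (lsmul ℝ ℝ) μ := by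
  induction k with
  | zero =>
    funext x
    rw [iteratedFDeriv_zero_eq_comp, iteratedFDeriv_zero_eq_comp, Function.comp_apply,
      convolution_lsmul, convolution_lsmul, ← LinearIsometryEquiv.coe_toContinuousLinearEquiv,
      ← ContinuousLinearEquiv.integral_comp_comm]
    simp only [map_smul, Function.comp_apply]
  | succ k ih =>
    funext x
    have hd : ContDiff ℝ 1 (iteratedFDeriv ℝ k g) :=
      hg.iteratedFDeriv_right (mod_cast le_top)
    rw [iteratedFDeriv_succ_eq_comp_left, ih, Function.comp_apply,
      ((hgs.iteratedFDeriv k).hasFDerivAt_convolution_right (lsmul ℝ ℝ) hκ hd x).fderiv,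
      convolution_def, convolution_lsmul]
    refine (ContinuousLinearEquiv.integral_comp_comm (𝕜 := ℝ) (E := V →L[ℝ] V [×k]→L[ℝ] ℝ)
      (F := V [×k.succ]→L[ℝ] ℝ) (μ := μ) (continuousMultilinearCurryLeftEquiv ℝ
      (fun _ : Fin (k + 1) => V) ℝ).symm.toContinuousLinearEquiv _).symm.trans ?_
    congr 1

section Polynomials

variable {n : ℕ}

theorem polynomialEmbedding_apply (p : MvPolynomial (Fin n) ℝ) (x : EuclideanSpace ℝ (Fin n)) :
    polynomialEmbedding n p x = MvPolynomial.eval (fun i => x i) p := by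
  induction p using MvPolynomial.induction_on with
  | C a =>
    rw [MvPolynomial.eval_C, polynomialEmbedding, ← MvPolynomial.algebraMap_eq, AlgHom.commutes]
    rfl
  | add p q hp hq => rw [map_add, map_add, ← hp, ← hq]; rfl
  | mul_X p i hp =>
    rw [map_mul, map_mul, ← hp, MvPolynomial.eval_X, polynomialEmbedding, MvPolynomial.aeval_X]
    rfl

theorem continuous_eval_polynomial (p : MvPolynomial (Fin n) ℝ) :
    Continuous fun x : EuclideanSpace ℝ (Fin n) => MvPolynomial.eval (fun i => x i) p := by
  simp only [← polynomialEmbedding_apply]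
  exact (polynomialEmbedding n p).contDiff.continuous

/-- The convolution of a compactly supported function with a polynomial is a polynomial. -/
theorem exists_polynomial_eq_integral (p : MvPolynomial (Fin n) ℝ) :
    ∀ g : EuclideanSpace ℝ (Fin n) → ℝ, Continuous g → HasCompactSupport g →
      ∃ q : MvPolynomial (Fin n) ℝ, ∀ x : EuclideanSpace ℝ (Fin n),
        MvPolynomial.eval (fun i => x i) q =
          ∫ y, MvPolynomial.eval (fun i => (x - y) i) p * g y := by
  have hint (p : MvPolynomial (Fin n) ℝ) (g : EuclideanSpace ℝ (Fin n) → ℝ) (hg : Continuous g)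
      (hgs : HasCompactSupport g) (x : EuclideanSpace ℝ (Fin n)) : MeasureTheory.Integrable
        fun y => MvPolynomial.eval (fun i => (x - y) i) p * g y :=
    (((continuous_eval_polynomial p).comp (continuous_const.sub continuous_id)).mul
      hg).integrable_of_hasCompactSupport hgs.mul_left
  induction p using MvPolynomial.induction_on with
  | C a =>
    intro g _ _
    refine ⟨MvPolynomial.C (a * ∫ y, g y), fun x => ?_⟩
    simp [MeasureTheory.integral_const_mul]
  | add p q hp hq =>
    intro g hg hgs
    obtain ⟨p', hp'⟩ := hp g hg hgs
    obtain ⟨q', hq'⟩ := hq g hg hgs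
    refine ⟨p' + q', fun x => ?_⟩
    rw [map_add, hp', hq', ← MeasureTheory.integral_add (hint p g hg hgs x) (hint q g hg hgs x)]
    simp only [map_add, add_mul]
  | mul_X p i hp =>
    intro g hg hgs
    have hgi : Continuous fun y : EuclideanSpace ℝ (Fin n) => y i * g y := by fun_prop
    obtain ⟨p', hp'⟩ := hp g hg hgs
    -- In the new factor `x i - y i`, the summand `y i` is absorbed into `g`; this is why the
    -- induction is over all `g`.
    obtain ⟨q', hq'⟩ := hp (fun y => y i * g y) hgi hgs.mul_left
    refine ⟨MvPolynomial.X i * p' - q', fun x => ?_⟩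
    rw [map_sub, map_mul, hp', hq', MvPolynomial.eval_X, ← MeasureTheory.integral_const_mul,
      ← MeasureTheory.integral_sub ((hint p g hg hgs x).const_mul _)
        (hint p _ hgi hgs.mul_left x)]
    congr 1
    funext y
    rw [map_mul, MvPolynomial.eval_X, PiLp.sub_apply]
    ring

/-- Polynomials are uniformly dense in the continuous functions on a compact set. -/
theorem exists_polynomial_near {f : EuclideanSpace ℝ (Fin n) → ℝ} (hf : Continuous f)
    {K : Set (EuclideanSpace ℝ (Fin n))} (hK : IsCompact K) {ε : ℝ} (hε : 0 < ε) :
    ∃ p : MvPolynomial (Fin n) ℝ, ∀ x ∈ K, |MvPolynomial.eval (fun i => x i) p - f x| < ε := by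
  have : CompactSpace K := isCompact_iff_compactSpace.1 hK
  let A : MvPolynomial (Fin n) ℝ →ₐ[ℝ] C(K, ℝ) :=
    MvPolynomial.aeval fun i => ⟨fun x : K => x.1 i, by fun_prop⟩
  have hA (p : MvPolynomial (Fin n) ℝ) (x : K) :
      A p x = MvPolynomial.eval (fun i => x.1 i) p := by
    induction p using MvPolynomial.induction_on with
    | C a =>
      rw [MvPolynomial.eval_C, ← MvPolynomial.algebraMap_eq, AlgHom.commutes]
      rfl
    | add p q hp hq => rw [map_add, map_add, ← hp, ← hq]; rfl
    | mul_X p i hp =>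
      rw [map_mul, map_mul, ← hp, MvPolynomial.eval_X, MvPolynomial.aeval_X]
      rfl
  have hsep : A.range.SeparatesPoints := by
    intro x y hxy
    obtain ⟨i, hi⟩ : ∃ i, x.1 i ≠ y.1 i := by
      by_contra! h
      exact hxy (Subtype.ext (PiLp.ext h))
    refine ⟨A (MvPolynomial.X i), ⟨A (MvPolynomial.X i), ⟨MvPolynomial.X i, rfl⟩, rfl⟩, ?_⟩
    simpa [hA] using hi
  obtain ⟨⟨_, p, rfl⟩, hp⟩ :=
    ContinuousMap.exists_mem_subalgebra_near_continuousMap_of_separatesPoints A.range hsep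
      ⟨fun x : K => f x, by fun_prop⟩ ε hε
  refine ⟨p, fun x hx => ?_⟩
  have := ((ContinuousMap.norm_lt_iff _ hε).1 hp) ⟨x, hx⟩
  rw [← Real.norm_eq_abs, ← hA p ⟨x, hx⟩]
  exact this

-- Only the values of the kernels where `G (x - y) ≠ 0` matter, so closeness on a compact set is
-- enough.
open MeasureTheory ContinuousLinearMap in
theorem norm_convolution_sub_le {F : Type v} [NormedAddCommGroup F] [NormedSpace ℝ F]
    [CompleteSpace F] {κ η : EuclideanSpace ℝ (Fin n) → ℝ} (hκ : Continuous κ) (hη : Continuous η)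
    {G : EuclideanSpace ℝ (Fin n) → F} (hG : Continuous G) (hGs : HasCompactSupport G)
    {x : EuclideanSpace ℝ (Fin n)} {ε : ℝ} (h : ∀ y, G (x - y) ≠ 0 → |κ y - η y| ≤ ε) :
    ‖convolution κ G (lsmul ℝ ℝ) volume x - convolution η G (lsmul ℝ ℝ) volume x‖ ≤
      ε * ∫ y, ‖G y‖ := by
  have hGx : Continuous fun y => G (x - y) := by fun_prop
  have hGxs : HasCompactSupport fun y => G (x - y) := hGs.comp_homeomorph (Homeomorph.subLeft x)
  have hint {φ : EuclideanSpace ℝ (Fin n) → ℝ} (hφ : Continuous φ) :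
      Integrable fun y => φ y • G (x - y) :=
    (hφ.smul hGx).integrable_of_hasCompactSupport hGxs.smul_left
  rw [convolution_lsmul, convolution_lsmul, ← integral_sub (hint hκ) (hint hη),
    ← integral_sub_left_eq_self (fun y => ‖G y‖) volume x, ← integral_const_mul]
  refine norm_integral_le_of_norm_le
    ((hGx.norm.integrable_of_hasCompactSupport hGxs.norm).const_mul ε) (.of_forall fun y => ?_)
  rw [← sub_smul, norm_smul, Real.norm_eq_abs]
  by_cases hy : G (x - y) = 0
  · simp [hy]
  · gcongr
    exact h y hy

-- A mollifier `η` is replaced by a polynomial `P` close to it on a large ball. Then `P * g`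
-- (convolution) is a polynomial, its derivatives are close to those of `η * g`, and these are close
-- to those of `g` by uniform continuity.
open MeasureTheory ContinuousLinearMap in
theorem exists_polynomial_near_of_hasCompactSupport {g : EuclideanSpace ℝ (Fin n) → ℝ}
    (hg : ContDiff ℝ ∞ g) (hgs : HasCompactSupport g) (N : ℕ) (r : ℝ) {ε : ℝ} (hε : 0 < ε) :
    ∃ p : MvPolynomial (Fin n) ℝ, ∀ k ≤ N, ∀ x : EuclideanSpace ℝ (Fin n), ‖x‖ ≤ r →
      ‖iteratedFDeriv ℝ k (polynomialEmbedding n p) x - iteratedFDeriv ℝ k g x‖ ≤ ε := by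
  have hcont (k : ℕ) : Continuous (iteratedFDeriv ℝ k g) :=
    hg.continuous_iteratedFDeriv (mod_cast le_top)
  obtain ⟨δ, hδ0, hδ⟩ : ∃ δ : ℝ, 0 < δ ∧ ∀ k ∈ Finset.range (N + 1), ∀ x y,
      dist x y < δ → dist (iteratedFDeriv ℝ k g x) (iteratedFDeriv ℝ k g y) < ε / 2 := by
    have : ∀ᶠ δ in 𝓝[>] (0 : ℝ), ∀ k ∈ Finset.range (N + 1), ∀ x y,
        dist x y < δ → dist (iteratedFDeriv ℝ k g x) (iteratedFDeriv ℝ k g y) < ε / 2 := by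
      refine (Filter.eventually_all_finset _).2 fun k _ => ?_
      obtain ⟨δ, hδ0, hδ⟩ := Metric.uniformContinuous_iff.1
        ((hgs.iteratedFDeriv k).uniformContinuous_of_continuous (hcont k)) (ε / 2) (half_pos hε)
      filter_upwards [Ioo_mem_nhdsGT hδ0] with δ' hδ' x y hxy
      exact hδ (hxy.trans hδ'.2)
    obtain ⟨δ, hδ, hδ0⟩ := (this.and self_mem_nhdsWithin).exists
    exact ⟨δ, hδ0, hδ⟩
  let φ : ContDiffBump (0 : EuclideanSpace ℝ (Fin n)) := ⟨δ / 2, δ, half_pos hδ0, half_lt_self hδ0⟩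
  set η := φ.normed volume with hη
  have hηc : Continuous η := φ.continuous_normed
  obtain ⟨ρ, hρ⟩ := hgs.isCompact.isBounded.subset_closedBall (0 : EuclideanSpace ℝ (Fin n))
  set S := ∑ k ∈ Finset.range (N + 1), ∫ y, ‖iteratedFDeriv ℝ k g y‖ with hS
  have hS0 : 0 ≤ S := Finset.sum_nonneg fun k _ => integral_nonneg fun y => norm_nonneg _
  -- If `‖x‖ ≤ r` and `x - y` lies in the support of `g`, then `‖y‖ ≤ r + ρ`. The tolerance is
  -- chosen so that its product with any of the integrals in `S` is at most `ε / 2`; the summand `1`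
  -- keeps the denominator positive.
  obtain ⟨P, hP⟩ := exists_polynomial_near hηc (isCompact_closedBall 0 (r + ρ))
    (ε := ε / (2 * (1 + S))) (by positivity)
  set κ : EuclideanSpace ℝ (Fin n) → ℝ := fun y => MvPolynomial.eval (fun i => y i) P with hκ
  have hκc : Continuous κ := continuous_eval_polynomial P
  obtain ⟨Q, hQ⟩ := exists_polynomial_eq_integral P g hg.continuous hgs
  have hQκ : (polynomialEmbedding n Q : EuclideanSpace ℝ (Fin n) → ℝ) =
      convolution κ g (lsmul ℝ ℝ) volume := by
    funext x
    rw [polynomialEmbedding_apply, hQ, convolution_lsmul_swap]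
    rfl
  refine ⟨Q, fun k hk x hx => ?_⟩
  rw [hQκ, iteratedFDeriv_convolution_lsmul hg hgs hκc.locallyIntegrable]
  have h1 := norm_convolution_sub_le hκc hηc (hcont k) (hgs.iteratedFDeriv k) (x := x)
    (ε := ε / (2 * (1 + S))) fun y hy => by
      refine (hP y (mem_closedBall_zero_iff.2 ?_)).le
      have hxy : ‖x - y‖ ≤ ρ := mem_closedBall_zero_iff.1
        (hρ (support_iteratedFDeriv_subset k hy))
      calc ‖y‖ = ‖x - (x - y)‖ := by rw [sub_sub_cancel]
        _ ≤ ‖x‖ + ‖x - y‖ := norm_sub_le _ _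
        _ ≤ r + ρ := add_le_add hx hxy
  have h2 : dist (convolution η (iteratedFDeriv ℝ k g) (lsmul ℝ ℝ) volume x)
      (iteratedFDeriv ℝ k g x) ≤ ε / 2 :=
    dist_convolution_le (half_pos hε).le (φ.support_normed_eq.subset) φ.nonneg_normed
      φ.integral_normed (hcont k).aestronglyMeasurable
      fun y hy => (hδ k (Finset.mem_range_succ_iff.2 hk) y x (Metric.mem_ball.1 hy)).le
  have h3 : ∫ y, ‖iteratedFDeriv ℝ k g y‖ ≤ S :=
    Finset.single_le_sum (f := fun k => ∫ y, ‖iteratedFDeriv ℝ k g y‖)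
      (fun k _ => integral_nonneg fun y => norm_nonneg _) (Finset.mem_range_succ_iff.2 hk)
  have h4 : ε / (2 * (1 + S)) * ∫ y, ‖iteratedFDeriv ℝ k g y‖ ≤ ε / 2 := by
    calc ε / (2 * (1 + S)) * ∫ y, ‖iteratedFDeriv ℝ k g y‖
        ≤ ε / (2 * (1 + S)) * (1 + S) := by gcongr; linarith
      _ = ε / 2 := by field_simp
  rw [dist_eq_norm] at h2
  refine (norm_sub_le_norm_sub_add_norm_sub _ _ _).trans
    ((add_le_add (h1.trans h4) h2).trans_eq (add_halves ε))

/-- Polynomials are dense in `C^∞(ℝⁿ)`. -/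
theorem denseRange_toSeminormed_polynomialEmbedding (n N : ℕ) :
    DenseRange fun p => SmoothFunctions.toSeminormed n N (polynomialEmbedding n p) := by
  intro f
  obtain ⟨f, rfl⟩ := (SmoothFunctions.toSeminormed n N).surjective f
  rw [Metric.mem_closure_range_iff]
  intro ε hε
  -- The cutoff equals `1` on a neighbourhood of the closed ball of radius `N`, so all derivatives
  -- of `χ * f` and `f` agree there.
  let χ : ContDiffBump (0 : EuclideanSpace ℝ (Fin n)) :=
    ⟨N + 1, N + 2, by positivity, by linarith⟩
  obtain ⟨p, hp⟩ := exists_polynomial_near_of_hasCompactSupport (g := fun x => χ x * f x)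
    (χ.contDiff.mul f.contDiff) χ.hasCompactSupport.mul_right N N (ε := ε / 2 ^ (N + 1))
    (by positivity)
  refine ⟨p, ?_⟩
  rw [dist_comm, dist_eq_norm, ← map_sub]
  refine lt_of_le_of_lt (SmoothFunctions.norm_toSeminormed_le _ (c := ε / 2 ^ (N + 1))
    (by positivity) fun k hk x hx => ?_) (?_ : 2 ^ N * (ε / 2 ^ (N + 1)) < ε)
  · have heq : (fun x => χ x * f x) =ᶠ[𝓝 x] f := by
      filter_upwards [Metric.isOpen_ball.mem_nhds (mem_ball_zero_iff.2
        (hx.trans_lt (lt_add_one (N : ℝ))))] with y hy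
      rw [χ.one_of_mem_closedBall (Metric.ball_subset_closedBall hy), one_mul]
    have := hp k hk x hx
    rw [(heq.iteratedFDeriv ℝ k).eq_of_nhds] at this
    refine le_trans (le_of_eq ?_) this
    exact congrArg norm (DFunLike.congr_fun (map_sub (SmoothFunctions.iteratedDerivative n k) _ _) x)
  · rw [pow_succ]
    field_simp
    norm_num

end Polynomials

/-- The character `θ ↦ e^{ik·θ}`. -/
def torusCharacter {n : ℕ} (k : Fin n → ℤ) (θ : Fin n → ℝ) : ℂ :=
  Complex.exp (Complex.I * ∑ j, (k j : ℂ) * θ j)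

/-! ### Fourier coefficients and the supremum norm -/

section FourierCoefficients

local instance unitAddCircleMeasureSpace : MeasureTheory.MeasureSpace UnitAddCircle :=
  ⟨AddCircle.haarAddCircle⟩

local instance unitAddCircleProbability :
    MeasureTheory.IsProbabilityMeasure (MeasureTheory.volume : MeasureTheory.Measure UnitAddCircle) :=
  inferInstanceAs (MeasureTheory.IsProbabilityMeasure AddCircle.haarAddCircle)

open UnitAddTorus in
/-- The coefficients of a trigonometric polynomial are bounded by its supremum norm. -/
theorem norm_coeff_le_of_trigonometric_sum_le {n : ℕ} {s : Finset (Fin n → ℤ)}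
    {c : (Fin n → ℤ) → ℂ} {M : ℝ} (hM : 0 ≤ M)
    (h : ∀ θ : Fin n → ℝ, ‖∑ k ∈ s, c k * torusCharacter k θ‖ ≤ M)
    {k : Fin n → ℤ} (hk : k ∈ s) : ‖c k‖ ≤ M := by
  let f : C(UnitAddTorus (Fin n), ℂ) := ∑ l ∈ s, c l • mFourier l
  have hf : ‖f‖ ≤ M := by
    refine (ContinuousMap.norm_le _ hM).2 fun x => ?_
    obtain ⟨t, rfl⟩ : ∃ t : Fin n → ℝ, x = fun j => ((t j : ℝ) : UnitAddCircle) := by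
      choose t ht using fun j => QuotientAddGroup.mk_surjective (x j)
      exact ⟨t, funext fun j => (ht j).symm⟩
    refine le_trans (le_of_eq ?_) (h fun j => 2 * Real.pi * t j)
    congr 1
    simp only [f, ContinuousMap.coe_sum, Finset.sum_apply, ContinuousMap.coe_smul, Pi.smul_apply,
      smul_eq_mul]
    refine Finset.sum_congr rfl fun l _ => ?_
    congr 1
    simp only [mFourier, ContinuousMap.coe_mk, fourier_coe_apply, torusCharacter]
    rw [← Complex.exp_sum, Finset.mul_sum]
    congr 1
    refine Finset.sum_congr rfl fun j _ => ?_
    push_cast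
    ring
  -- The coefficient is an inner product with a unit vector, and for a probability measure the `L²`
  -- norm is at most the supremum norm.
  have hinner : inner ℂ (mFourierLp 2 k) (ContinuousMap.toLp (E := ℂ) 2 MeasureTheory.volume ℂ f) =
      c k := by
    simp only [f, map_sum, map_smul]
    exact (orthonormal_mFourier (d := Fin n)).inner_right_sum c hk
  rw [← hinner]
  refine (norm_inner_le_norm _ _).trans ?_
  rw [(orthonormal_mFourier (d := Fin n)).1 k, one_mul]
  refine (ContinuousLinearMap.le_opNorm _ _).trans ?_
  refine (mul_le_mul (ContinuousMap.toLp_norm_le _) hf (norm_nonneg _) (by positivity)).trans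
    (le_of_eq ?_)
  have hone : MeasureTheory.measureUnivNNReal
      (MeasureTheory.volume : MeasureTheory.Measure (UnitAddTorus (Fin n))) = 1 := by
    simp [MeasureTheory.measureUnivNNReal]
  rw [hone, NNReal.coe_one, Real.one_rpow, one_mul]

end FourierCoefficients

theorem iteratedDeriv_sum_exp {ι : Type u} (s : Finset ι) (a b : ι → ℂ) (N : ℕ) :
    iteratedDeriv N (fun t : ℝ => ∑ k ∈ s, a k * Complex.exp (b k * t)) =
      fun t : ℝ => ∑ k ∈ s, a k * b k ^ N * Complex.exp (b k * t) := by
  induction N with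
  | zero => simp
  | succ N ih =>
    rw [iteratedDeriv_succ, ih]
    funext t
    refine HasDerivAt.deriv (HasDerivAt.fun_sum fun k _ => ?_)
    have h1 : HasDerivAt (fun t : ℝ => b k * (t : ℂ)) (b k * 1) t :=
      (Complex.ofRealCLM.hasDerivAt (x := t)).const_mul (b k)
    refine (h1.cexp.const_mul (a k * b k ^ N)).congr_deriv ?_
    rw [pow_succ]
    ring

/-- The algebra of trigonometric polynomials in `n` variables. -/
abbrev TrigonometricPolynomial (n : ℕ) : Type := AddMonoidAlgebra ℂ (Fin n → ℤ)

/-! ### Trigonometric polynomials `p (R sin θ)`: decay of coefficients and evaluation at units -/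

namespace TrigonometricPolynomial

variable {n : ℕ}

/-- The evaluation of trigonometric polynomials at `n` commuting units. -/
def evalUnits {A : Type u} [CommRing A] [Algebra ℂ A] (u : Fin n → Aˣ) :
    TrigonometricPolynomial n →ₐ[ℂ] A :=
  AddMonoidAlgebra.lift ℂ A (Fin n → ℤ)
    { toFun := fun k => ((∏ j, u j ^ k.toAdd j : Aˣ) : A)
      map_one' := by simp
      map_mul' := fun k l => by
        rw [← Units.val_mul, ← Finset.prod_mul_distrib]
        simp only [toAdd_mul, Pi.add_apply, zpow_add] }

theorem evalUnits_apply {A : Type u} [CommRing A] [Algebra ℂ A] (u : Fin n → Aˣ)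
    (G : TrigonometricPolynomial n) :
    evalUnits u G = ∑ k ∈ G.coeff.support, G.coeff k • ((∏ j, u j ^ k j : Aˣ) : A) :=
  AddMonoidAlgebra.lift_apply _ _

/-- The trigonometric polynomial `p (R sin θ₁, …, R sin θₙ)`. -/
def ofPolynomial (R : ℝ) : MvPolynomial (Fin n) ℝ →ₐ[ℝ] TrigonometricPolynomial n :=
  MvPolynomial.aeval fun j => ((R : ℂ) / (2 * Complex.I)) •
    (AddMonoidAlgebra.single (Pi.single j 1) 1 - AddMonoidAlgebra.single (-Pi.single j 1) 1)

/-- Both sides are homomorphisms in `p`, so variables suffice. It is used twice: at the numbers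
`e^{iθ_j}` to recover a function on the torus, and at the elements `e^{ic_j}` of a Banach algebra.
-/
theorem evalUnits_ofPolynomial {A : Type u} [CommRing A] [Algebra ℂ A] (u : Fin n → Aˣ) (R : ℝ)
    (p : MvPolynomial (Fin n) ℝ) : evalUnits u (ofPolynomial R p) =
      MvPolynomial.aeval (fun j => ((R : ℂ) / (2 * Complex.I)) •
        ((u j : A) - ((u j)⁻¹ : Aˣ))) p := by
  have h : ((evalUnits u).restrictScalars ℝ).comp (ofPolynomial R) =
      MvPolynomial.aeval (fun j => ((R : ℂ) / (2 * Complex.I)) •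
        ((u j : A) - ((u j)⁻¹ : Aˣ))) := by
    ext j
    have hsingle (m : ℤ) : ∏ i, u i ^ (Pi.single j m : Fin n → ℤ) i = u j ^ m := by
      rw [Finset.prod_eq_single j (fun i _ hi => by simp [Pi.single_eq_of_ne hi]) (by simp)]
      simp
    have h1 (m : ℤ) : evalUnits u (AddMonoidAlgebra.single (Pi.single j m) 1) =
        ((u j ^ m : Aˣ) : A) := by
      rw [evalUnits, AddMonoidAlgebra.lift_single, one_smul]
      exact congrArg (fun v : Aˣ => (v : A)) (hsingle m)
    rw [AlgHom.comp_apply, ofPolynomial, MvPolynomial.aeval_X, MvPolynomial.aeval_X,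
      AlgHom.restrictScalars_apply, map_smul, map_sub, ← Pi.single_neg, h1, h1, zpow_one,
      zpow_neg_one]
  exact DFunLike.congr_fun h p

theorem sum_torusCharacter (R : ℝ) (p : MvPolynomial (Fin n) ℝ) (θ : Fin n → ℝ) :
    ∑ k ∈ (ofPolynomial R p).coeff.support, (ofPolynomial R p).coeff k * torusCharacter k θ =
      (MvPolynomial.eval (fun j => R * Real.sin (θ j)) p : ℝ) := by
  let u : Fin n → ℂˣ := fun j => Units.mk0 (Complex.exp (Complex.I * θ j)) (Complex.exp_ne_zero _)
  have h := evalUnits_ofPolynomial u R p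
  rw [evalUnits_apply] at h
  have hu (k : Fin n → ℤ) : ((∏ j, u j ^ k j : ℂˣ) : ℂ) = torusCharacter k θ := by
    rw [torusCharacter, Finset.mul_sum, Complex.exp_sum, Units.coe_prod]
    refine Finset.prod_congr rfl fun j _ => ?_
    rw [Units.val_zpow_eq_zpow_val, Units.val_mk0, ← Complex.exp_int_mul]
    congr 1
    ring
  have hx (j : Fin n) : ((R : ℂ) / (2 * Complex.I)) • ((u j : ℂ) - ((u j)⁻¹ : ℂˣ)) =
      ((R * Real.sin (θ j) : ℝ) : ℂ) := by
    rw [Units.val_inv_eq_inv_val, Units.val_mk0, ← Complex.exp_neg, smul_eq_mul]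
    push_cast
    rw [Complex.sin, show Complex.I * (θ j : ℂ) = θ j * Complex.I by ring,
      show -((θ j : ℂ) * Complex.I) = -(θ j : ℂ) * Complex.I by ring]
    field_simp
    rw [Complex.I_sq]
    ring
  simp only [hu, hx, smul_eq_mul] at h
  rw [h]
  exact (MvPolynomial.aeval_algebraMap_apply ℂ (fun j => R * Real.sin (θ j)) p).trans
    (congrArg _ (DFunLike.congr_fun (MvPolynomial.coe_aeval_eq_eval _) p))

/-- The curve obtained by varying the `j`-th angle in `(R sin θ₁, …, R sin θₙ)`. -/
def sineCurve (R : ℝ) (θ : Fin n → ℝ) (j : Fin n) (t : ℝ) : EuclideanSpace ℝ (Fin n) :=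
  WithLp.toLp 2 (Function.update (fun i => R * Real.sin (θ i)) j 0) +
    (R * Real.sin (θ j + t)) • EuclideanSpace.single j (1 : ℝ)

theorem sineCurve_apply (R : ℝ) (θ : Fin n → ℝ) (j : Fin n) (t : ℝ) (i : Fin n) :
    sineCurve R θ j t i = R * Real.sin ((θ + Pi.single j t : Fin n → ℝ) i) := by
  rcases eq_or_ne i j with rfl | h
  · simp [sineCurve]
  · simp [sineCurve, h]

theorem contDiff_sineCurve (R : ℝ) (θ : Fin n → ℝ) (j : Fin n) :
    ContDiff ℝ ∞ (sineCurve R θ j) := by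
  unfold sineCurve
  fun_prop

theorem norm_le_of_abs_le {R : ℝ} (hR : 0 ≤ R) (x : EuclideanSpace ℝ (Fin n))
    (hx : ∀ i, |x i| ≤ R) : ‖x‖ ≤ n * R := by
  refine abs_le_of_sq_le_sq' ?_ (by positivity) |>.2
  rw [EuclideanSpace.norm_sq_eq]
  calc ∑ i, ‖x i‖ ^ 2 ≤ ∑ _i : Fin n, R ^ 2 :=
        Finset.sum_le_sum fun i _ => pow_le_pow_left₀ (norm_nonneg _) (hx i) 2
    _ = n * R ^ 2 := by simp
    _ ≤ (n * R) ^ 2 := by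
        rw [mul_pow]
        gcongr
        exact_mod_cast Nat.le_self_pow two_ne_zero n

theorem abs_mul_sin_le {R : ℝ} (hR : 0 ≤ R) (t : ℝ) : |R * Real.sin t| ≤ R := by
  rw [abs_mul, abs_of_nonneg hR]
  exact mul_le_of_le_one_right hR (Real.abs_sin_le_one t)

theorem norm_sineCurve_le {R : ℝ} (hR : 0 ≤ R) (θ : Fin n → ℝ) (j : Fin n) (t : ℝ) :
    ‖sineCurve R θ j t‖ ≤ n * R :=
  norm_le_of_abs_le hR _ fun i => by
    rw [sineCurve_apply]
    exact abs_mul_sin_le hR _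

theorem norm_iteratedFDeriv_sineCurve_le {R : ℝ} (hR : 0 ≤ R) (θ : Fin n → ℝ) (j : Fin n) (t : ℝ)
    {i : ℕ} (hi : 1 ≤ i) : ‖iteratedFDeriv ℝ i (sineCurve R θ j) t‖ ≤ R := by
  have hsin : ContDiff ℝ ∞ fun t => R * Real.sin (θ j + t) := by fun_prop
  let L : ℝ →L[ℝ] EuclideanSpace ℝ (Fin n) :=
    (ContinuousLinearMap.id ℝ ℝ).smulRight (EuclideanSpace.single j (1 : ℝ))
  have hL : ‖L‖ ≤ 1 := by
    rw [ContinuousLinearMap.norm_smulRight_apply, PiLp.norm_single, norm_one, mul_one]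
    exact ContinuousLinearMap.norm_id_le
  have h1 : iteratedDeriv i (sineCurve R θ j) t =
      iteratedDeriv i (L ∘ fun t => R * Real.sin (θ j + t)) t :=
    iteratedDeriv_const_add (by omega) _
  rw [norm_iteratedFDeriv_eq_norm_iteratedDeriv, h1, ← norm_iteratedFDeriv_eq_norm_iteratedDeriv]
  refine (L.norm_iteratedFDeriv_comp_left hsin.contDiffAt (n := i) (mod_cast le_top)).trans ?_
  rw [norm_iteratedFDeriv_eq_norm_iteratedDeriv, iteratedDeriv_const_mul_field,
    iteratedDeriv_comp_const_add, norm_mul, Real.norm_of_nonneg hR]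
  have h2 := Real.abs_iteratedDeriv_sin_le_one i (θ j + t)
  rw [Real.norm_eq_abs]
  exact (mul_le_of_le_one_left (by positivity) hL).trans (mul_le_of_le_one_right hR h2)

/-- The curve stays in the ball of radius `n * R ≤ M`, where the seminorm controls `f`, and its
derivatives are bounded by `R ≤ R ^ i`; the Faà di Bruno estimate combines the two. -/
theorem abs_iteratedDeriv_comp_sineCurve_le {R : ℝ} (hR : 1 ≤ R) (f : SmoothFunctions n)
    {N M : ℕ} (hNM : N ≤ M) (hRM : n * R ≤ M) (θ : Fin n → ℝ) (j : Fin n) (t : ℝ) :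
    ‖iteratedDeriv N (fun t => (f (sineCurve R θ j t) : ℂ)) t‖ ≤
      N.factorial * ‖SmoothFunctions.toSeminormed n M f‖ * R ^ N := by
  have hcomp : ContDiff ℝ ∞ (f ∘ sineCurve R θ j) :=
    f.contDiff.comp (contDiff_sineCurve R θ j)
  rw [← norm_iteratedFDeriv_eq_norm_iteratedDeriv]
  refine (Complex.ofRealLI.norm_iteratedFDeriv_comp_left hcomp.contDiffAt (i := N)
    (mod_cast le_top)).trans_le ?_
  refine norm_iteratedFDeriv_comp_le f.contDiff (contDiff_sineCurve R θ j) (mod_cast le_top) t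
    (fun i hi => ?_) fun i hi _ => ?_
  · exact SmoothFunctions.norm_iteratedFDeriv_le (hi.trans hNM) f
      ((norm_sineCurve_le (by linarith) θ j t).trans hRM)
  · exact (norm_iteratedFDeriv_sineCurve_le (by linarith) θ j t hi).trans
      (le_self_pow₀ hR (by omega))

theorem torusCharacter_add_single (k : Fin n → ℤ) (θ : Fin n → ℝ) (j : Fin n) (t : ℝ) :
    torusCharacter k (θ + Pi.single j t) =
      torusCharacter k θ * Complex.exp (Complex.I * k j * t) := by
  rw [torusCharacter, torusCharacter, ← Complex.exp_add]
  congr 1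
  have h : ∑ i, (k i : ℂ) * ((Pi.single j t : Fin n → ℝ) i : ℂ) = k j * t := by
    rw [Finset.sum_eq_single j (fun i _ hi => by simp [hi]) (by simp)]
    simp
  simp only [Pi.add_apply, Complex.ofReal_add, mul_add, Finset.sum_add_distrib, h]
  ring

/-- The decay of the coefficients of `p (R sin θ₁, …, R sin θₙ)`. -/
theorem abs_pow_mul_norm_coeff_le {R : ℝ} (hR : 1 ≤ R) (p : MvPolynomial (Fin n) ℝ)
    {N M : ℕ} (hNM : N ≤ M) (hRM : n * R ≤ M) (j : Fin n) (k : Fin n → ℤ) :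
    |(k j : ℝ)| ^ N * ‖(ofPolynomial R p).coeff k‖ ≤
      N.factorial * ‖SmoothFunctions.toSeminormed n M (polynomialEmbedding n p)‖ * R ^ N := by
  set G := ofPolynomial R p
  by_cases hk : k ∈ G.coeff.support
  swap
  · rw [Finsupp.notMem_support_iff.1 hk, norm_zero, mul_zero]
    positivity
  have key : ‖(Complex.I * k j) ^ N * G.coeff k‖ ≤
      N.factorial * ‖SmoothFunctions.toSeminormed n M (polynomialEmbedding n p)‖ * R ^ N := by
    -- Differentiating `N` times in the `j`-th angle multiplies the `k`-th coefficient by `(i k_j) ^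
    -- N`; the coefficient bound is applied to this derivative.
    refine norm_coeff_le_of_trigonometric_sum_le (s := G.coeff.support)
      (c := fun k => (Complex.I * k j) ^ N * G.coeff k) (by positivity) (fun θ => ?_) hk
    refine le_trans (le_of_eq ?_)
      (abs_iteratedDeriv_comp_sineCurve_le hR (polynomialEmbedding n p) hNM hRM θ j 0)
    have hfun : (fun t => ((polynomialEmbedding n p (sineCurve R θ j t) : ℝ) : ℂ)) =
        fun t : ℝ => ∑ k ∈ G.coeff.support, (G.coeff k * torusCharacter k θ) *
          Complex.exp (Complex.I * k j * t) := by
      funext t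
      rw [polynomialEmbedding_apply]
      simp only [sineCurve_apply]
      rw [← sum_torusCharacter]
      refine Finset.sum_congr rfl fun k _ => ?_
      rw [torusCharacter_add_single, ← mul_assoc]
    rw [hfun, iteratedDeriv_sum_exp]
    congr 1
    refine Finset.sum_congr rfl fun k _ => ?_
    simp only [Complex.ofReal_zero, mul_zero, Complex.exp_zero, mul_one]
    ring
  simpa using key

theorem norm_coeff_le {R : ℝ} (hR : 0 ≤ R) (p : MvPolynomial (Fin n) ℝ) {M : ℕ}
    (hRM : n * R ≤ M) (k : Fin n → ℤ) : ‖(ofPolynomial R p).coeff k‖ ≤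
      ‖SmoothFunctions.toSeminormed n M (polynomialEmbedding n p)‖ := by
  by_cases hk : k ∈ (ofPolynomial R p).coeff.support
  swap
  · rw [Finsupp.notMem_support_iff.1 hk, norm_zero]
    exact norm_nonneg _
  refine norm_coeff_le_of_trigonometric_sum_le (norm_nonneg _) (fun θ => ?_) hk
  rw [sum_torusCharacter, Complex.norm_real, Real.norm_eq_abs]
  have hx := SmoothFunctions.abs_apply_le (N := M) (polynomialEmbedding n p)
    (x := WithLp.toLp 2 fun j => R * Real.sin (θ j))
    ((norm_le_of_abs_le hR _ fun i => abs_mul_sin_le hR _).trans hRM)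
  rwa [polynomialEmbedding_apply] at hx

/-- The index with the largest `|k i|` dominates, so decay in one direction at a time suffices. The
first alternative covers `n = 0`, where there is no index. -/
theorem prod_one_add_abs_pow_le (k : Fin n → ℤ) (d : ℕ) :
    ∏ j, (1 + |(k j : ℝ)|) ^ d ≤ 1 ∨
      ∃ i, ∏ j, (1 + |(k j : ℝ)|) ^ d ≤ (1 + |(k i : ℝ)|) ^ (n * d) := by
  rcases isEmpty_or_nonempty (Fin n) with h | h
  · exact Or.inl (by simp)
  · obtain ⟨i, -, hi⟩ := Finset.exists_max_image Finset.univ (fun j => |(k j : ℝ)|)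
      Finset.univ_nonempty
    refine Or.inr ⟨i, ?_⟩
    calc ∏ j, (1 + |(k j : ℝ)|) ^ d ≤ ∏ _j : Fin n, (1 + |(k i : ℝ)|) ^ d := by
          refine Finset.prod_le_prod (fun j _ => by positivity) fun j hj => ?_
          have := hi j hj
          gcongr
      _ = (1 + |(k i : ℝ)|) ^ (n * d) := by
          rw [Finset.prod_const, Finset.card_univ, Fintype.card_fin, ← pow_mul, mul_comm]

/-- Here `n * d` derivatives are spent in the direction of the largest frequency, and `M` is taken
large enough for both that order and the radius `n * R`. -/
theorem exists_norm_coeff_mul_prod_le (n d : ℕ) {R : ℝ} (hR : 1 ≤ R) :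
    ∃ (M : ℕ) (C : ℝ), 0 ≤ C ∧ ∀ (p : MvPolynomial (Fin n) ℝ) (k : Fin n → ℤ),
      ‖(ofPolynomial R p).coeff k‖ * ∏ j, (1 + |(k j : ℝ)|) ^ d ≤
        C * ‖SmoothFunctions.toSeminormed n M (polynomialEmbedding n p)‖ := by
  obtain ⟨M, hRM, hNM⟩ := SmoothFunctions.exists_nat_ge_and_ge (n * R) (n * d)
  set N := n * d
  refine ⟨M, 2 ^ N * (1 + N.factorial * R ^ N), by positivity, fun p k => ?_⟩
  set q := ‖SmoothFunctions.toSeminormed n M (polynomialEmbedding n p)‖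
  have hq : 0 ≤ q := norm_nonneg _
  have hc : ‖(ofPolynomial R p).coeff k‖ ≤ q := norm_coeff_le (by linarith) p hRM k
  rcases prod_one_add_abs_pow_le k d with h | ⟨i, h⟩
  · calc ‖(ofPolynomial R p).coeff k‖ * ∏ j, (1 + |(k j : ℝ)|) ^ d ≤ q * 1 := by gcongr
      _ = 1 * 1 * q := by ring
      _ ≤ 2 ^ N * (1 + N.factorial * R ^ N) * q := by
          gcongr
          · exact one_le_pow₀ one_le_two
          · exact le_add_of_nonneg_right (by positivity)
  · have h1 := abs_pow_mul_norm_coeff_le hR p hNM hRM i k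
    have h2 : (1 + |(k i : ℝ)|) ^ N ≤ 2 ^ N * (1 + |(k i : ℝ)| ^ N) := by
      refine (add_pow_le zero_le_one (abs_nonneg _) N).trans ?_
      rw [one_pow]
      gcongr
      · exact one_le_two
      · exact Nat.sub_le N 1
    calc ‖(ofPolynomial R p).coeff k‖ * ∏ j, (1 + |(k j : ℝ)|) ^ d
        ≤ ‖(ofPolynomial R p).coeff k‖ * (2 ^ N * (1 + |(k i : ℝ)| ^ N)) := by
          gcongr
          exact h.trans h2
      _ = 2 ^ N * (‖(ofPolynomial R p).coeff k‖ +
            |(k i : ℝ)| ^ N * ‖(ofPolynomial R p).coeff k‖) := by ring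
      _ ≤ 2 ^ N * (q + N.factorial * q * R ^ N) := by gcongr
      _ = _ := by ring

theorem summable_inv_one_add_abs_sq : Summable fun l : ℤ => ((1 + |(l : ℝ)|) ^ 2)⁻¹ := by
  have h : Summable fun m : ℕ => ((1 + (m : ℝ)) ^ 2)⁻¹ := by
    have := (summable_nat_add_iff 1).2 (Real.summable_nat_pow_inv.2 one_lt_two)
    refine this.congr fun m => ?_
    push_cast
    rw [add_comm]
  refine Summable.of_nat_of_neg ?_ ?_ <;> simpa using h

/-- The finite set sits in a box, over which the sum of products factors. -/
theorem sum_prod_le_pow_tsum {w : ℤ → ℝ} (hw : Summable w) (hw0 : ∀ l, 0 ≤ w l)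
    (s : Finset (Fin n → ℤ)) : ∑ k ∈ s, ∏ j, w (k j) ≤ (∑' l, w l) ^ n := by
  classical
  calc ∑ k ∈ s, ∏ j, w (k j)
      ≤ ∑ k ∈ Fintype.piFinset fun j => s.image fun k => k j, ∏ j, w (k j) :=
        Finset.sum_le_sum_of_subset_of_nonneg
          (fun k hk => Fintype.mem_piFinset.2 fun j => Finset.mem_image_of_mem _ hk)
          fun k _ _ => Finset.prod_nonneg fun j _ => hw0 _
    _ = ∏ j, ∑ l ∈ s.image fun k => k j, w l := by
        rw [Finset.prod_univ_sum]
    _ ≤ ∏ _j : Fin n, ∑' l, w l :=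
        Finset.prod_le_prod (fun j _ => Finset.sum_nonneg fun l _ => hw0 l)
          fun j _ => hw.sum_le_tsum _ fun l _ => hw0 l
    _ = _ := by simp

theorem norm_prod_zpow_le {A : Type u} [NormedCommRing A] [NormOneClass A] (u : Fin n → Aˣ)
    {K : ℝ} {m : ℕ} (hu : ∀ j (l : ℤ), ‖((u j ^ l : Aˣ) : A)‖ ≤ K * (1 + |(l : ℝ)|) ^ m)
    (k : Fin n → ℤ) :
    ‖((∏ j, u j ^ k j : Aˣ) : A)‖ ≤ |K| ^ n * ∏ j, (1 + |(k j : ℝ)|) ^ m := by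
  rw [Units.coe_prod]
  calc ‖∏ j, ((u j ^ k j : Aˣ) : A)‖ ≤ ∏ j, ‖((u j ^ k j : Aˣ) : A)‖ :=
        Finset.norm_prod_le _ _
    _ ≤ ∏ j, |K| * (1 + |(k j : ℝ)|) ^ m :=
        Finset.prod_le_prod (fun _ _ => norm_nonneg _) fun j _ => (hu j (k j)).trans
          (mul_le_mul_of_nonneg_right (le_abs_self K) (by positivity))
    _ = |K| ^ n * ∏ j, (1 + |(k j : ℝ)|) ^ m := by
        rw [Finset.prod_mul_distrib, Finset.prod_const, Finset.card_univ, Fintype.card_fin]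

theorem prod_one_add_abs_pow_eq (k : Fin n → ℤ) (m : ℕ) :
    ∏ j, (1 + |(k j : ℝ)|) ^ m =
      (∏ j, (1 + |(k j : ℝ)|) ^ (m + 2)) * ∏ j, ((1 + |(k j : ℝ)|) ^ 2)⁻¹ := by
  rw [← Finset.prod_mul_distrib]
  refine Finset.prod_congr rfl fun j _ => ?_
  have : (1 + |(k j : ℝ)|) ≠ 0 := by positivity
  rw [pow_add, mul_assoc, mul_inv_cancel₀ (pow_ne_zero 2 this), mul_one]

/-- If the powers of `u₁, …, uₙ` grow polynomially, then `p (R sin θ₁, …, R sin θₙ)` can be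
evaluated at `e^{iθⱼ} = uⱼ` with a bound by finitely many derivatives of `p`. -/
theorem exists_norm_evalUnits_le {A : Type u} [NormedCommRing A] [NormOneClass A] [Algebra ℂ A]
    (hsmul : ∀ (c : ℂ) (a : A), ‖c • a‖ ≤ 2 * (‖c‖ * ‖a‖)) (u : Fin n → Aˣ) {K : ℝ} {m : ℕ}
    (hu : ∀ j (l : ℤ), ‖((u j ^ l : Aˣ) : A)‖ ≤ K * (1 + |(l : ℝ)|) ^ m) {R : ℝ} (hR : 1 ≤ R) :
    ∃ (M : ℕ) (C : ℝ), ∀ p : MvPolynomial (Fin n) ℝ, ‖evalUnits u (ofPolynomial R p)‖ ≤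
      C * ‖SmoothFunctions.toSeminormed n M (polynomialEmbedding n p)‖ := by
  -- Of the decay exponent `m + 2`, the part `m` cancels the growth of the units and the remaining
  -- `2` makes the series over the frequencies converge.
  obtain ⟨M, C, hC, h⟩ := exists_norm_coeff_mul_prod_le n (m + 2) hR
  refine ⟨M, 2 * |K| ^ n * C * (∑' l : ℤ, ((1 + |(l : ℝ)|) ^ 2)⁻¹) ^ n, fun p => ?_⟩
  generalize hq : ‖SmoothFunctions.toSeminormed n M (polynomialEmbedding n p)‖ = q
  have hq0 : 0 ≤ q := hq ▸ norm_nonneg _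
  have hp := h p
  rw [hq] at hp
  generalize ofPolynomial R p = G at hp ⊢
  have hterm (k : Fin n → ℤ) : ‖G.coeff k • ((∏ j, u j ^ k j : Aˣ) : A)‖ ≤
      2 * |K| ^ n * (C * q) * ∏ j, ((1 + |(k j : ℝ)|) ^ 2)⁻¹ := by
    have hw0 : 0 ≤ ∏ j, ((1 + |(k j : ℝ)|) ^ 2)⁻¹ := Finset.prod_nonneg fun j _ => by positivity
    calc ‖G.coeff k • ((∏ j, u j ^ k j : Aˣ) : A)‖
        ≤ 2 * (‖G.coeff k‖ * ‖((∏ j, u j ^ k j : Aˣ) : A)‖) := hsmul _ _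
      _ ≤ 2 * (‖G.coeff k‖ * (|K| ^ n * ∏ j, (1 + |(k j : ℝ)|) ^ m)) :=
          mul_le_mul_of_nonneg_left
            (mul_le_mul_of_nonneg_left (norm_prod_zpow_le u hu k) (norm_nonneg _)) zero_le_two
      _ = 2 * |K| ^ n * (‖G.coeff k‖ * ∏ j, (1 + |(k j : ℝ)|) ^ (m + 2)) *
            ∏ j, ((1 + |(k j : ℝ)|) ^ 2)⁻¹ := by
          rw [prod_one_add_abs_pow_eq]; ring
      _ ≤ _ := mul_le_mul_of_nonneg_right
          (mul_le_mul_of_nonneg_left (hp k) (by positivity)) hw0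
  rw [evalUnits_apply]
  calc ‖∑ k ∈ G.coeff.support, G.coeff k • ((∏ j, u j ^ k j : Aˣ) : A)‖
      ≤ ∑ k ∈ G.coeff.support, 2 * |K| ^ n * (C * q) * ∏ j, ((1 + |(k j : ℝ)|) ^ 2)⁻¹ :=
        norm_sum_le_of_le _ fun k _ => hterm k
    _ = 2 * |K| ^ n * (C * q) *
          ∑ k ∈ G.coeff.support, ∏ j, ((1 + |(k j : ℝ)|) ^ 2)⁻¹ := by rw [Finset.mul_sum]
    _ ≤ 2 * |K| ^ n * (C * q) * (∑' l : ℤ, ((1 + |(l : ℝ)|) ^ 2)⁻¹) ^ n :=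
        mul_le_mul_of_nonneg_left
          (sum_prod_le_pow_tsum summable_inv_one_add_abs_sq (fun l => by positivity) _)
          (by positivity)
    _ = _ := by ring

end TrigonometricPolynomial

/-! ### Bounding homomorphisms from polynomials to PG algebras -/

section PolynomialGrowth

variable {B : Type u} [NonUnitalNormedRing B] [NormedSpace ℝ B] [IsScalarTower ℝ B B]
  [SMulCommClass ℝ B B]

theorem AdjoinOne.mul_comm_of_commutative (hcomm : ∀ a b : B, a * b = b * a) (a b : AdjoinOne B) :
    a * b = b * a := by
  apply WithLp.ofLp_injective 1
  change WithLp.ofLp a * WithLp.ofLp b = WithLp.ofLp b * WithLp.ofLp a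
  ext
  · simp [mul_comm]
  · simp only [Unitization.snd_mul]
    rw [hcomm, add_comm (_ • _)]

/-- The complexification of `B₊` is commutative if `B` is. -/
abbrev ComplexUnitization.normedCommRing (hcomm : ∀ a b : B, a * b = b * a) :
    NormedCommRing (ComplexUnitization B) :=
  { (inferInstance : NormedRing (ComplexUnitization B)) with
    mul_comm := fun z w => by
      ext1
      · rw [Complexification.re_mul, Complexification.re_mul,
          AdjoinOne.mul_comm_of_commutative hcomm z.re,
          AdjoinOne.mul_comm_of_commutative hcomm z.im]
      · rw [Complexification.im_mul, Complexification.im_mul,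
          AdjoinOne.mul_comm_of_commutative hcomm z.re,
          AdjoinOne.mul_comm_of_commutative hcomm z.im, add_comm] }

/-- The one-parameter group `s ↦ e^{isc}`. -/
def expIHom [CompleteSpace B] (c : B) : Multiplicative ℝ →* ComplexUnitization B where
  toFun s := expI (s.toAdd • c)
  map_one' := by
    have : toComplexification (0 : B) = 0 := map_zero toComplexificationCLM
    simp [expI, this, NormedSpace.exp_zero]
  map_mul' s t := by
    have h (r : ℝ) : (toComplexification (r • c) : ComplexUnitization B) =
        r • toComplexification c := map_smul toComplexificationCLM r c
    rw [expI, expI, expI, h, h, h, toAdd_mul, add_smul, smul_add]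
    exact NormedSpace.exp_add_of_commute
      ((((Commute.refl _).smul_left _).smul_right _).smul_left _ |>.smul_right _)

/-- The invertible element `e^{ic}`. -/
def expIUnit [CompleteSpace B] (c : B) : (ComplexUnitization B)ˣ :=
  (expIHom c).toHomUnits (Multiplicative.ofAdd 1)

theorem coe_expIUnit_zpow [CompleteSpace B] (c : B) (l : ℤ) :
    ((expIUnit c ^ l : (ComplexUnitization B)ˣ) : ComplexUnitization B) = expI ((l : ℝ) • c) := by
  rw [expIUnit, ← map_zpow, MonoidHom.coe_toHomUnits]
  simp [expIHom, toAdd_zpow]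

theorem coe_expIUnit [CompleteSpace B] (c : B) :
    (expIUnit c : ComplexUnitization B) = expI c := by
  simpa using coe_expIUnit_zpow c 1

theorem coe_inv_expIUnit [CompleteSpace B] (c : B) :
    ((expIUnit c)⁻¹ : (ComplexUnitization B)ˣ) = expI (-c) := by
  simpa using coe_expIUnit_zpow c (-1)

/-- The growth of finitely many elements of polynomial growth has a common integer exponent. -/
theorem IsPG.exists_norm_expIUnit_zpow_le [CompleteSpace B] (hB : IsPG B) {n : ℕ} (c : Fin n → B) :
    ∃ (K : ℝ) (m : ℕ), ∀ j (l : ℤ),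
      ‖((expIUnit (c j) ^ l : (ComplexUnitization B)ˣ) : ComplexUnitization B)‖ ≤
        K * (1 + |(l : ℝ)|) ^ m := by
  choose K hK α hα h using fun j => (isOfPolynomialGrowth_iff_expI (c j)).1 (hB.2 (c j))
  refine ⟨∑ j, K j, ∑ j, ⌈α j⌉₊, fun j l => ?_⟩
  rw [coe_expIUnit_zpow]
  have h1 : (1 : ℝ) ≤ 1 + |(l : ℝ)| := le_add_of_nonneg_right (abs_nonneg _)
  refine (h j l).trans (mul_le_mul ?_ ?_ (by positivity) (Finset.sum_nonneg fun j _ => (hK j).le))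
  · exact Finset.single_le_sum (fun j _ => (hK j).le) (Finset.mem_univ j)
  · rw [← Real.rpow_natCast]
    refine Real.rpow_le_rpow_of_exponent_le h1 ((Nat.le_ceil _).trans ?_)
    exact_mod_cast Finset.single_le_sum (f := fun j => ⌈α j⌉₊) (fun _ _ => Nat.zero_le _)
      (Finset.mem_univ j)

/-- Finitely many elements of a Banach algebra are multiples of sines, with a common factor. -/
theorem exists_smul_expIUnit_sub_inv_eq [CompleteSpace B] {n : ℕ} (b : Fin n → B) :
    ∃ (R : ℝ) (c : Fin n → B), 1 ≤ R ∧ ∀ j, ((R : ℂ) / (2 * Complex.I)) •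
      ((expIUnit (c j) : ComplexUnitization B) - ((expIUnit (c j))⁻¹ : (ComplexUnitization B)ˣ)) =
        toComplexification (b j) := by
  obtain ⟨r, hr, h⟩ := exists_expI_sub_expI_neg_eq (B := B)
  -- Dividing by this `R` brings every `b j` into the ball of radius `r`, where elements are sines.
  set R : ℝ := 1 + (∑ j, ‖b j‖) / r
  have hR : 1 ≤ R := le_add_of_nonneg_right (by positivity)
  have hR0 : 0 < R := one_pos.trans_le hR
  have hb (j) : ‖R⁻¹ • b j‖ < r := by
    rw [norm_smul, norm_inv, Real.norm_of_nonneg hR0.le, inv_mul_lt_iff₀ hR0]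
    have : ‖b j‖ ≤ ∑ j, ‖b j‖ :=
      Finset.single_le_sum (f := fun j => ‖b j‖) (fun _ _ => norm_nonneg _) (Finset.mem_univ j)
    have : R * r = r + ∑ j, ‖b j‖ := by simp only [R]; field_simp
    linarith
  choose c hc using fun j => h _ (hb j)
  refine ⟨R, c, hR, fun j => ?_⟩
  have hsmul : (toComplexification (R⁻¹ • b j) : ComplexUnitization B) =
      R⁻¹ • toComplexification (b j) := map_smul toComplexificationCLM _ _
  have hreal : (R⁻¹ • toComplexification (b j) : ComplexUnitization B) =
      ((R⁻¹ : ℝ) : ℂ) • toComplexification (b j) := rfl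
  rw [coe_expIUnit, coe_inv_expIUnit, hc, hsmul, hreal, smul_smul, smul_smul]
  have : (R : ℂ) ≠ 0 := by exact_mod_cast hR0.ne'
  have h1 : (R : ℂ) / (2 * Complex.I) * (2 * Complex.I) * ((R⁻¹ : ℝ) : ℂ) = 1 := by
    push_cast
    field_simp
  rw [h1, one_smul]

-- Writing the images of the variables as `R sin c_j` turns `φ` into evaluation of trigonometric
-- polynomials at `e^{ic_j}`, to which `exists_norm_evalUnits_le` applies.
open TrigonometricPolynomial in
theorem exists_norm_map_le_of_commutative (hcomm : ∀ a b : B, a * b = b * a) (hB : IsPG B) {n : ℕ}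
    (φ : MvPolynomial (Fin n) ℝ →ₙₐ[ℝ] B) : ∃ (M : ℕ) (C : ℝ), ∀ p,
      ‖φ p‖ ≤ C * ‖SmoothFunctions.toSeminormed n M (polynomialEmbedding n p)‖ := by
  have := hB.1
  obtain ⟨R, c, hR, hc⟩ := exists_smul_expIUnit_sub_inv_eq fun j => φ (MvPolynomial.X j)
  obtain ⟨K, m, hK⟩ := hB.exists_norm_expIUnit_zpow_le c
  let _ := ComplexUnitization.normedCommRing hcomm
  have : NormOneClass (ComplexUnitization B) := ⟨ComplexUnitization.norm_one⟩
  obtain ⟨M, C, h⟩ := exists_norm_evalUnits_le (A := ComplexUnitization B)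
    Complexification.norm_complex_smul_le (fun j => expIUnit (c j)) hK hR
  refine ⟨M, ‖φ 1‖ * C, fun p => ?_⟩
  -- Evaluation in the complexification of `B₊` is unital but `φ` need not be; the factor `φ 1`
  -- corrects the constants.
  have key : toComplexification (φ p) =
      toComplexification (φ 1) * evalUnits (fun j => expIUnit (c j)) (ofPolynomial R p) := by
    rw [evalUnits_ofPolynomial]
    simp only [hc]
    induction p using MvPolynomial.induction_on with
    | C r =>
      have hr : φ (MvPolynomial.C r) = r • φ 1 := by
        rw [← map_smul, ← MvPolynomial.algebraMap_eq, Algebra.algebraMap_eq_smul_one]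
      rw [MvPolynomial.aeval_C, hr, Algebra.algebraMap_eq_smul_one, mul_smul_comm, mul_one]
      exact map_smul toComplexificationCLM r (φ 1)
    | add p q hp hq =>
      rw [map_add, map_add, mul_add, ← hp, ← hq]
      exact map_add toComplexificationCLM _ _
    | mul_X p j hp =>
      rw [map_mul, map_mul, MvPolynomial.aeval_X, ← mul_assoc, ← hp]
      exact map_mul toComplexificationHom _ _
  rw [← norm_toComplexification, key, mul_assoc]
  refine (norm_mul_le _ _).trans ?_
  rw [norm_toComplexification]
  exact mul_le_mul_of_nonneg_left (h p) (norm_nonneg _)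

/-- The restriction of the norm to a subalgebra. -/
instance NonUnitalSubalgebra.normedSpaceReal (S : NonUnitalSubalgebra ℝ B) : NormedSpace ℝ S :=
  { (inferInstance : Module ℝ S) with
    norm_smul_le := fun r x => norm_smul_le r (x : B) }

/-- Closedness gives completeness, and the inclusion is isometric, so exponentials have the same
norm in both algebras. -/
theorem IsPG.of_isClosed (hB : IsPG B) {S : NonUnitalSubalgebra ℝ B} (hS : IsClosed (S : Set B)) :
    IsPG S := by
  have := hB.1
  have hcomplete : CompleteSpace S := hS.completeSpace_coe
  exact ⟨hcomplete, fun b =>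
    (isOfPolynomialGrowth_map_iff (NonUnitalSubalgebraClass.subtype S) (fun _ => rfl) b).1
      (hB.2 b)⟩

/-- A homomorphism from the polynomials to a Banach algebra of polynomial growth is bounded by
finitely many derivatives. -/
theorem IsPG.exists_norm_map_le (hB : IsPG B) {n : ℕ} (φ : MvPolynomial (Fin n) ℝ →ₙₐ[ℝ] B) :
    ∃ (M : ℕ) (C : ℝ), ∀ p,
      ‖φ p‖ ≤ C * ‖SmoothFunctions.toSeminormed n M (polynomialEmbedding n p)‖ := by
  -- Images of polynomials commute, hence so does their closure, which remains in PG; this reduces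
  -- to the commutative case.
  let S := (NonUnitalAlgHom.range φ).topologicalClosure
  have hcomm : ∀ a b : S, a * b = b * a := by
    let _ := (NonUnitalAlgHom.range φ).nonUnitalCommRingTopologicalClosure (by
      rintro ⟨_, p, rfl⟩ ⟨_, q, rfl⟩
      apply Subtype.ext
      change φ p * φ q = φ q * φ p
      rw [← map_mul, mul_comm, map_mul])
    exact fun a b => mul_comm a b
  exact exists_norm_map_le_of_commutative hcomm
    (hB.of_isClosed (NonUnitalAlgHom.range φ).isClosed_topologicalClosure)
    (NonUnitalAlgHom.codRestrict φ S fun p =>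
      NonUnitalSubalgebra.le_topologicalClosure _ ⟨p, rfl⟩)

end PolynomialGrowth

/-! ### Extension to smooth functions and the universal property -/

/-- The topology pulled back along a linear map is a locally convex vector space topology, hence
coarser than the strongest one. -/
theorem continuous_of_strongestLocallyConvexTopology {V : Type u} {E : Type v} [AddCommGroup V]
    [Module ℝ V] [AddCommGroup E] [Module ℝ E] [t : TopologicalSpace E] [IsTopologicalAddGroup E]
    [ContinuousSMul ℝ E] [LocallyConvexSpace ℝ E] (f : V →ₗ[ℝ] E) :
    @Continuous V E (strongestLocallyConvexTopology V) t f :=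
  continuous_iff_le_induced.2 <| sInf_le
    ⟨topologicalAddGroup_induced f, continuousSMul_induced f, LocallyConvexSpace.induced f⟩

namespace SmoothFunctions

variable {n : ℕ}

/-- The seminorms increase with `N`, so each neighbourhood contains one defined by a single
seminorm. -/
theorem denseRange_of_toSeminormed {X : Type u} {e : X → SmoothFunctions n}
    (h : ∀ N, DenseRange fun x => toSeminormed n N (e x)) : DenseRange e := by
  intro f
  rw [mem_closure_iff_nhds]
  intro U hU
  have hnhds : 𝓝 f = ⨅ N, Filter.comap (toSeminormed n N) (𝓝 (toSeminormed n N f)) := by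
    rw [topology_eq_iInf, nhds_iInf]
    simp only [nhds_induced]
  have hanti : Antitone fun N =>
      Filter.comap (toSeminormed n N) (𝓝 (toSeminormed n N f)) := by
    intro M N hMN
    refine Filter.tendsto_iff_comap.1 (tendsto_iff_norm_sub_tendsto_zero.2 ?_)
    refine squeeze_zero (fun _ => norm_nonneg _) (fun g => ?_)
      (tendsto_iff_norm_sub_tendsto_zero.1
        (Filter.tendsto_comap (f := toSeminormed n N) (x := 𝓝 (toSeminormed n N f))))
    rw [← map_sub, ← map_sub]
    exact norm_toSeminormed_mono hMN _
  rw [hnhds, Filter.mem_iInf_of_directed hanti.directed_ge] at hU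
  obtain ⟨N, V, hV, hVU⟩ := hU
  obtain ⟨_, hx, x, rfl⟩ := mem_closure_iff_nhds.1 (h N (toSeminormed n N f)) V hV
  exact ⟨e x, hVU hx, x, rfl⟩

end SmoothFunctions

theorem denseRange_polynomialEmbedding (n : ℕ) : DenseRange (polynomialEmbedding n) :=
  SmoothFunctions.denseRange_of_toSeminormed (denseRange_toSeminormed_polynomialEmbedding n)

theorem continuous_polynomialEmbedding (n : ℕ) :
    @Continuous _ _ (strongestLocallyConvexTopology (MvPolynomial (Fin n) ℝ)) _
      (polynomialEmbedding n) := by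
  rw [SmoothFunctions.topology_eq_iInf]
  refine continuous_iInf_rng.2 fun N => continuous_induced_rng.2 ?_
  exact continuous_of_strongestLocallyConvexTopology
    ((SmoothFunctions.toSeminormed n N).toLinearMap.comp (polynomialEmbedding n).toLinearMap)

/-- The smooth functional calculus: a homomorphism from the polynomials to a Banach algebra of
polynomial growth extends continuously to the smooth functions. -/
theorem IsPG.exists_continuous_extension {B : Type u} [NonUnitalNormedRing B] [NormedSpace ℝ B]
    [IsScalarTower ℝ B B] [SMulCommClass ℝ B B] (hB : IsPG B) {n : ℕ}
    (φ : MvPolynomial (Fin n) ℝ →ₙₐ[ℝ] B) :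
    ∃ ψ : SmoothFunctions n →ₙₐ[ℝ] B, Continuous ψ ∧ ∀ p, ψ (polynomialEmbedding n p) = φ p := by
  have := hB.1
  obtain ⟨M, C, h⟩ := hB.exists_norm_map_le φ
  let e : MvPolynomial (Fin n) ℝ →ₗ[ℝ] SeminormedSmooth n M :=
    (SmoothFunctions.toSeminormed n M).toLinearMap.comp (polynomialEmbedding n).toLinearMap
  let f : MvPolynomial (Fin n) ℝ →ₗ[ℝ] B := φ
  have he : DenseRange e := denseRange_toSeminormed_polynomialEmbedding n M
  -- The a priori bound makes `φ` continuous for the `M`-th seminorm, so it extends from the dense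
  -- polynomials to all smooth functions.
  let g : SeminormedSmooth n M →L[ℝ] B := f.extendOfNorm e
  have hg (p) : g (e p) = φ p := LinearMap.extendOfNorm_eq he ⟨C, h⟩ p
  have hmul (x y) : g (x * y) = g x * g y := by
    refine he.induction_on₂ (p := fun x y => g (x * y) = g x * g y)
      (isClosed_eq (by fun_prop) (by fun_prop)) (fun p q => ?_) x y
    have : e p * e q = e (p * q) := by simp [e]
    rw [this, hg, hg, hg, map_mul]
  refine ⟨
    { toFun := fun F => g (SmoothFunctions.toSeminormed n M F)
      map_smul' := fun r F => by simp
      map_zero' := by simp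
      map_add' := fun F G => by simp
      map_mul' := fun F G => by rw [map_mul, hmul] },
    g.continuous.comp (SmoothFunctions.continuous_toSeminormed M), hg⟩

theorem IsPGL.t2Space {A : Type v} [NonUnitalRing A] [Module ℝ A] [TopologicalSpace A]
    (hA : IsPGL A) : T2Space A := by
  obtain ⟨I, _, _, _, S, e, he⟩ := hA
  exact he.isEmbedding.t2Space

/-- Each coordinate of the projective limit is a Banach algebra in PG and is treated separately; the
extensions are compatible because they are so on the dense polynomials. -/
theorem IsPGL.exists_continuous_extension {B : Type u} [NonUnitalRing B] [Module ℝ B]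
    [TopologicalSpace B] (hB : IsPGL B) {n : ℕ} (φ : MvPolynomial (Fin n) ℝ →ₙₐ[ℝ] B) :
    ∃ ψ : SmoothFunctions n →ₙₐ[ℝ] B, Continuous ψ ∧ ∀ p, ψ (polynomialEmbedding n p) = φ p := by
  obtain ⟨I, _, _, _, S, e, he⟩ := hB
  choose ψ hψ hψφ using fun i => (S.isPG i).exists_continuous_extension
    { toFun := fun p => (e (φ p)).1 i
      map_smul' := fun r p => by simp
      map_zero' := by simp
      map_add' := fun p q => by simp
      map_mul' := fun p q => by simp }
  have hmem (F : SmoothFunctions n) : (fun i => ψ i F) ∈ S.limit := by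
    intro i j hij
    refine congrFun ((denseRange_polynomialEmbedding n).equalizer
      ((S.continuous_map hij).comp (hψ j)) (hψ i) (funext fun p => ?_)) F
    simp only [Function.comp_apply, hψφ]
    exact (e (φ p)).2 i j hij
  let E : B ≃ S.limit := Equiv.ofBijective e he.bijective
  have hE (F) : e (E.symm ⟨fun i => ψ i F, hmem F⟩) = ⟨fun i => ψ i F, hmem F⟩ :=
    E.apply_symm_apply _
  refine ⟨
    { toFun := fun F => E.symm ⟨fun i => ψ i F, hmem F⟩
      map_smul' := fun r F => he.injective ?_
      map_zero' := he.injective ?_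
      map_add' := fun F G => he.injective ?_
      map_mul' := fun F G => he.injective ?_ }, ?_, fun p => he.injective ?_⟩
  · rw [hE, MonoidHom.id_apply, map_smul, hE]
    ext i
    simp
  · rw [hE, map_zero]
    ext i
    simp
  · rw [hE, map_add, hE, hE]
    ext i
    simp
  · rw [hE, map_mul, hE, hE]
    ext i
    simp
  · refine he.isEmbedding.continuous_iff.2 ?_
    refine ((continuous_pi hψ).subtype_mk hmem).congr fun F => (hE F).symm
  · refine (hE _).trans (Subtype.ext (funext fun i => ?_))
    exact hψφ i p

end

theorem mainTheorem8 (n : ℕ) :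
    letI : TopologicalSpace (MvPolynomial (Fin n) ℝ) :=
      strongestLocallyConvexTopology (MvPolynomial (Fin n) ℝ)
    IsPGEnvelope.{u} (polynomialEmbedding n : MvPolynomial (Fin n) ℝ →ₙₐ[ℝ] SmoothFunctions n) := by
  refine @IsPGEnvelope.mk _ _ _ _ (strongestLocallyConvexTopology _) _ _ _ _
    (SmoothFunctions.isPGL n) (continuous_polynomialEmbedding n) fun B _ _ _ hB φ _ => ?_
  obtain ⟨ψ, hψ, hψφ⟩ := hB.exists_continuous_extension φ
  have := hB.t2Space
  -- Uniqueness: continuous maps into a Hausdorff space that agree on the dense polynomials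
  -- coincide.
  refine ⟨ψ, ⟨hψ, hψφ⟩, fun χ hχ => DFunLike.coe_injective ?_⟩
  exact (denseRange_polynomialEmbedding n).equalizer hχ.1 hψ
    (funext fun p => (hχ.2 p).trans (hψφ p).symm)
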